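/- Let $\alpha,\beta,c_1,c_2>0$, let $\gamma_1^{\rm thr},\gamma_2^{\rm thr}>0$, and let $\tilde h_1,\tilde h_2$ be independent Gamma-Gamma random variables, i.e. with density $$\frac{2(\alpha\beta)^{(\alpha+\beta)/2}}{\Gamma(\alpha)\Gamma(\beta)}\,x^{(\alpha+\beta)/2-1}K_{\alpha-\beta}\big(2\sqrt{\alpha\beta x}\big),\qquad x>0,$$ where $K_\nu$ is the modified Bessel function of the second kind. At transmit SNR $\gamma>0$ the received SNRs of the two base stations (BSs) are $\gamma_i=c_i\gamma\tilde h_i^2$, $i=1,2$. The signals are decoded successively. If BS$_i$ is decoded first and BS$_j$ second, then BS$_i$ has SINR $\Gamma_i=\gamma_i/(\gamma_j+1)$; let $s=1$ if $\Gamma_i\ge\gamma_i^{\rm thr}$ and $s=0$ otherwise. The SINR of BS$_j$ is then $\Gamma_j=\gamma_j$ under perfect successive interference cancellation (SIC), $\Gamma_j=\gamma_j/((1-s)\gamma_i+1)$ under imperfect SIC, and $\Gamma_j=s\gamma_j$ under worst-case SIC. The decoding order of the optimal dynamic NOMA scheme is a function of $(\gamma_1,\gamma_2)$: with $\hat\gamma_1=\gamma_1/(\gamma_2+1)$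 and $\hat\gamma_2=\gamma_2/(\gamma_1+1)$, BS$_1$ is decoded first if $\hat\gamma_1\ge\gamma_1^{\rm thr}$ and $\hat\gamma_2<\gamma_2^{\rm thr}$, BS$_2$ is decoded first if $\hat\gamma_1<\gamma_1^{\rm thr}$ and $\hat\gamma_2\ge\gamma_2^{\rm thr}$, and the order is arbitrary otherwise. Let $P_i^{\rm out}(\gamma)=\Pr(\Gamma_i<\gamma_i^{\rm thr})$ be the outage probability of BS$_i$, and let $c=c_2/c_1$. Put $$F_1(x)=\frac1{\Gamma(\alpha)\Gamma(\beta)}\Big[\frac{\Gamma(\beta-\alpha)}{\alpha}x^\alpha+\frac{\Gamma(\alpha-\beta)}{\beta}x^\beta\Big]\quad(\alpha-\beta\notin\mathbb Z),$$ $$F_2(x)=\frac1{\Gamma(\alpha)^2\Gamma(\beta)^2}\,G^{2,3}_{3,3}\Big[x\,\Big|\,{1-\alpha,\,1-\beta,\,1\atop \alpha,\ \beta,\ 0}\Big],$$ where Meijer's $G$-function is the Mellin–Barnes integral along any vertical line $\mathrm{Re}\,s=\sigma$ with $0<\sigma<\min\{\alpha,\beta\}$. For $x>0$, $F_2(x)=\Pr(\tilde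 h_1/\tilde h_2\le x)$. Moreover: (i) Suppose $\gamma_1^{\rm thr}\gamma_2^{\rm thr}<1$, under perfect, imperfect or worst-case SIC. If $\alpha-\beta\notin\mathbb Z$, then for $i=1,2$ $$P_i^{\rm out}(\gamma)\sim F_1\Big(\alpha\beta\sqrt{\gamma_i^{\rm thr}/(c_i\gamma)}\Big)\qquad(\gamma\to\infty),$$ i.e. the ratio of the two sides tends to $1$. For all $\alpha,\beta>0$ there is no outage floor, $P_i^{\rm out}(\gamma)\to0$, and the diversity order is $\lim_{\gamma\to\infty}-\log P_i^{\rm out}(\gamma)/\log\gamma=\tfrac12\min\{\alpha,\beta\}$. (ii) Suppose $\gamma_1^{\rm thr}\gamma_2^{\rm thr}\ge1$, under imperfect or worst-case SIC. Then $$\lim_{\gamma\to\infty}P_1^{\rm out}(\gamma)=\lim_{\gamma\to\infty}P_2^{\rm out}(\gamma)=F_2\Big(\sqrt{c\,\gamma_1^{\rm thr}}\Big)-F_2\Big(\sqrt{c/\gamma_2^{\rm thr}}\Big),$$ and this common floor is positive if $\gamma_1^{\rm thr}\gamma_2^{\rm thr}>1$. -/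

import Mathlib

open Filter Topology MeasureTheory ProbabilityTheory Asymptotics

noncomputable section

namespace FSONOMA

/-- The modified Bessel function of the second kind `K_ν(x)`, for `x > 0`, by its standard integral
representation `K_ν(x) = ∫₀^∞ exp(-x cosh t) cosh(ν t) dt`. -/
def besselK (ν x : ℝ) : ℝ :=
  ∫ t in Set.Ioi (0 : ℝ), Real.exp (-x * Real.cosh t) * Real.cosh (ν * t)

/-- The density of the Gamma-Gamma distribution with parameters `α` and `β`. -/
def gammaGammaPDF (α β x : ℝ) : ℝ :=
  if 0 < x then
    2 * (α * β) ^ ((α + β) / 2) / (Real.Gamma α * Real.Gamma β)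
      * x ^ ((α + β) / 2 - 1) * besselK (α - β) (2 * √(α * β * x))
  else 0

/-- The Gamma-Gamma distribution with parameters `α` and `β`. -/
def gammaGamma (α β : ℝ) : Measure ℝ :=
  volume.withDensity fun x => ENNReal.ofReal (gammaGammaPDF α β x)

/-- The integrand of the Mellin-Barnes integral of Meijer's `G^{m,n}_{p,q}[x | a; b]`:
`∏_{j ≤ m} Γ(b_j - s) ∏_{k ≤ n} Γ(1 - a_k + s) /
  (∏_{j > m} Γ(1 - b_j + s) ∏_{k > n} Γ(a_k - s)) · x^s`
(the indices in `Fin` start at `0`). -/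
def meijerIntegrand (m n : ℕ) {p q : ℕ} (a : Fin p → ℂ) (b : Fin q → ℂ) (x : ℝ) (s : ℂ) : ℂ :=
  (∏ j : Fin q, if (j : ℕ) < m then Complex.Gamma (b j - s) else (Complex.Gamma (1 - b j + s))⁻¹)
    * (∏ k : Fin p,
        if (k : ℕ) < n then Complex.Gamma (1 - a k + s) else (Complex.Gamma (a k - s))⁻¹)
    * (x : ℂ) ^ s

/-- Meijer's function `G^{m,n}_{p,q}[x | a; b]`, that is `(2πi)⁻¹ ∫ meijerIntegrand ds` along the
upward vertical line `Re s = σ`. The line has to separate the poles of the `Γ(b_j - s)`, `j ≤ m`,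
from the poles of the `Γ(1 - a_k + s)`, `k ≤ n`, see `Separates`. -/
def meijerG (σ : ℝ) (m n : ℕ) {p q : ℕ} (a : Fin p → ℂ) (b : Fin q → ℂ) (x : ℝ) : ℂ :=
  (2 * Real.pi : ℂ)⁻¹ * ∫ t : ℝ, meijerIntegrand m n a b x (σ + t * Complex.I)

/-- The line `Re s = σ` has the poles of `Γ(b_j - s)`, `j ≤ m`, on its right and the poles of
`Γ(1 - a_k + s)`, `k ≤ n`, on its left. -/
def Separates (σ : ℝ) (m n : ℕ) {p q : ℕ} (a : Fin p → ℂ) (b : Fin q → ℂ) : Prop :=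
  (∀ j : Fin q, (j : ℕ) < m → σ < (b j).re) ∧ (∀ k : Fin p, (k : ℕ) < n → (a k).re - 1 < σ)

/-- The upper parameters `1 - α, 1 - β, 1` of the Meijer function in `F₂`. -/
def upperParams (α β : ℝ) : Fin 3 → ℂ := ![1 - (α : ℂ), 1 - (β : ℂ), 1]

/-- The lower parameters `α, β, 0` of the Meijer function in `F₂`. -/
def lowerParams (α β : ℝ) : Fin 3 → ℂ := ![(α : ℂ), (β : ℂ), 0]

/-- `F₁(x) = (Γ(β-α)/α · x^α + Γ(α-β)/β · x^β) / (Γ(α) Γ(β))`, for `α - β` not an integer. -/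
def F₁ (α β x : ℝ) : ℝ :=
  1 / (Real.Gamma α * Real.Gamma β)
    * (Real.Gamma (β - α) / α * x ^ α + Real.Gamma (α - β) / β * x ^ β)

/-- `F₂(x) = G^{2,3}_{3,3}[x | 1-α, 1-β, 1; α, β, 0] / (Γ(α)² Γ(β)²)`, with the Mellin-Barnes
integral along `Re s = σ`. The value of this Meijer function is real for `x > 0`. -/
def F₂ (σ α β x : ℝ) : ℝ :=
  1 / (Real.Gamma α ^ 2 * Real.Gamma β ^ 2)
    * (meijerG σ 2 3 (upperParams α β) (lowerParams α β) x).re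

/-- The assumptions on the reliability of successive interference cancellation (SIC). -/
inductive SIC
  | perfect
  | imperfect
  | worstCase

/-- The decoding orders `(1,2)` and `(2,1)`. -/
inductive DecodingOrder
  | o12
  | o21

/-- SINR of the signal decoded first: received SNR `x`, interfering SNR `y`. -/
def sinrFirst (x y : ℝ) : ℝ := x / (y + 1)

open Classical in
/-- The variable `s`: one if the signal decoded first (received SNR `x`, interfering SNR `y`,
threshold `thr`) is decoded successfully, zero otherwise. -/
def sicSuccess (thr x y : ℝ) : ℝ := if thr ≤ sinrFirst x y then 1 else 0

/-- SINR of the signal decoded second: received SNR `x`, SNR `y` of the signal decoded first,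
success variable `s` of the signal decoded first. -/
def sinrSecond (sic : SIC) (s x y : ℝ) : ℝ :=
  match sic with
  | .perfect => x
  | .imperfect => x / ((1 - s) * y + 1)
  | .worstCase => s * x

/-- SINR `Γ₁` of the first base station, for received SNRs `g₁`, `g₂`; `t₂` is the threshold of
the second base station. -/
def sinr₁ (sic : SIC) (o : DecodingOrder) (t₂ g₁ g₂ : ℝ) : ℝ :=
  match o with
  | .o12 => sinrFirst g₁ g₂
  | .o21 => sinrSecond sic (sicSuccess t₂ g₂ g₁) g₁ g₂

/-- SINR `Γ₂` of the second base station, for received SNRs `g₁`, `g₂`; `t₁` is the threshold of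
the first base station. -/
def sinr₂ (sic : SIC) (o : DecodingOrder) (t₁ g₁ g₂ : ℝ) : ℝ :=
  match o with
  | .o12 => sinrSecond sic (sicSuccess t₁ g₁ g₂) g₂ g₁
  | .o21 => sinrFirst g₂ g₁

/-- `o` is a policy of the optimal dynamic scheme: the decoding order is a function of the received
SNRs, it is `(1,2)` if only the first base station meets its threshold when decoded first, `(2,1)`
if only the second one does, and arbitrary otherwise. -/
def IsOptimalPolicy (t₁ t₂ : ℝ) (o : ℝ → ℝ → DecodingOrder) : Prop :=
  ∀ g₁ g₂ : ℝ, 0 ≤ g₁ → 0 ≤ g₂ →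
    (t₁ ≤ g₁ / (g₂ + 1) ∧ g₂ / (g₁ + 1) < t₂ → o g₁ g₂ = .o12) ∧
    (g₁ / (g₂ + 1) < t₁ ∧ t₂ ≤ g₂ / (g₁ + 1) → o g₁ g₂ = .o21)

/-- Received SNR `c γ h²` for transmit SNR `γ`, deterministic power gain `c` and turbulence `h`. -/
def receivedSNR (c γ h : ℝ) : ℝ := c * γ * h ^ 2

variable {Ω : Type*} [MeasurableSpace Ω]

/-- Outage probability `Pr(Γ₁ < t₁)` of the first base station at transmit SNR `γ`. -/
def outage₁ (μ : Measure Ω) (sic : SIC) (o : ℝ → ℝ → DecodingOrder) (t₁ t₂ c₁ c₂ : ℝ)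
    (h₁ h₂ : Ω → ℝ) (γ : ℝ) : ℝ :=
  μ.real {ω | sinr₁ sic (o (receivedSNR c₁ γ (h₁ ω)) (receivedSNR c₂ γ (h₂ ω))) t₂
    (receivedSNR c₁ γ (h₁ ω)) (receivedSNR c₂ γ (h₂ ω)) < t₁}

/-- Outage probability `Pr(Γ₂ < t₂)` of the second base station at transmit SNR `γ`. -/
def outage₂ (μ : Measure Ω) (sic : SIC) (o : ℝ → ℝ → DecodingOrder) (t₁ t₂ c₁ c₂ : ℝ)
    (h₁ h₂ : Ω → ℝ) (γ : ℝ) : ℝ :=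
  μ.real {ω | sinr₂ sic (o (receivedSNR c₁ γ (h₁ ω)) (receivedSNR c₂ γ (h₂ ω))) t₁
    (receivedSNR c₁ γ (h₁ ω)) (receivedSNR c₂ γ (h₂ ω)) < t₂}

/-- `P` has diversity order `d`: `-log P(γ) / log γ → d` as the SNR `γ` tends to infinity. -/
def HasDiversityOrder (P : ℝ → ℝ) (d : ℝ) : Prop :=
  Tendsto (fun γ => -Real.log (P γ) / Real.log γ) atTop (𝓝 d)

end FSONOMA

end

/-!
The Gamma-Gamma law is the law of a product of two independent Gamma variables: the substitution
`v = b exp t` in the integral of `K_{α-β}` writes its density as `C x^(α-1) besselInt (β-α) (αβx)`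
(`gammaGammaPDF_of_pos`), which is the density of such a product (`gammaGamma_eq_map`). Everything
that is needed about the law follows from these two descriptions.

*Behaviour near zero.* The function `besselInt` is decreasing, and for `α < β` it tends to
`Γ(β-α)` at `0`. Hence the distribution function `F` satisfies `F(x) ∼ C Γ(β-α) x^α / α`, which is
the leading term of `F₁(αβx)` (`gammaGamma_Iio_isEquivalent_F₁`). For all `α, β`, also for
`α = β` where a logarithm appears, `F(x)` lies between multiples of `x^m` and `x^(m-ε)` with
`m = min α β`, which suffices for the diversity order.

*The quotient.* By the product description the complex moments of the law are products of Gamma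
functions, so the tail of `h₂ / h₁` has the Mellin transform
`Γ(α-s) Γ(β-s) Γ(α+s) Γ(β+s) / (s Γ(α)² Γ(β)²)`. It is integrable along vertical lines since
`|Γ(z)| ≤ Γ(Re z + 1) / |z|`, and the quotient has no atoms, so Mellin inversion gives `F₂`
(`measureReal_div_le_eq_F₂`).

*Outage events.* Write `a`, `b` for the received SNRs and `N` for the event
`a < t₁ (b + 1)`, `b < t₂ (a + 1)` that neither signal can be decoded first. Outside of `N` the
optimal policy decodes first a signal that succeeds, so that BS₁ is in outage iff `a < t₁`; in any
case `a < t₁` forces an outage. If `t₁ t₂ < 1`, then `a` and `b` are both bounded on `N`, so by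
independence `N` has a probability of smaller order than that of `a < t₁` (`outage₁_bounds`). If the
cancellation is not perfect, then `N` is contained in the outage event, and as the SNR grows it
converges to an event on the quotient `h₁ / h₂` (`tendsto_outage₁_floor`). The policy may fail to be
measurable, so outage events are only ever compared with measurable ones. The second base station
is treated by exchanging the roles (`outage₂_eq_outage₁_swap`).
-/

namespace FSONOMA

/-! ### The density of the Gamma-Gamma distribution as a mixture -/

/-- The integral `∫₀^∞ v^(p-1) exp(-v - w/v) dv`: up to elementary factors a modified Bessel
function of the second kind of order `p`, and at `w = 0` the integral of `Γ(p)`. -/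
noncomputable def besselInt (p w : ℝ) : ℝ :=
  ∫ v in Set.Ioi (0 : ℝ), v ^ (p - 1) * Real.exp (-v - w / v)

lemma measurable_besselInt_integrand (p w : ℝ) :
    Measurable fun v : ℝ => v ^ (p - 1) * Real.exp (-v - w / v) := by
  fun_prop

/-- For `w > 0` the integral converges for every real `p`, because `exp(-w/v) ≤ n! (v/w)^n`. -/
lemma integrableOn_besselInt (p : ℝ) {w : ℝ} (hw : 0 < w) :
    IntegrableOn (fun v : ℝ => v ^ (p - 1) * Real.exp (-v - w / v)) (Set.Ioi 0) := by
  obtain ⟨n, hn⟩ := exists_nat_gt (-p)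
  have hpn : 0 < p + n := by linarith
  refine Integrable.mono' ((Real.GammaIntegral_convergent hpn).const_mul (n.factorial / w ^ n))
    (measurable_besselInt_integrand p w).aestronglyMeasurable ?_
  refine (ae_restrict_iff' measurableSet_Ioi).2 (Eventually.of_forall fun v hv => ?_)
  have hv : 0 < v := hv
  rw [Real.norm_of_nonneg (by positivity), sub_eq_add_neg (-v), Real.exp_add]
  have h1 : (w / v) ^ n / n.factorial ≤ Real.exp (w / v) :=
    Real.pow_div_factorial_le_exp _ (by positivity) n
  have h2 : Real.exp (-(w / v)) ≤ n.factorial / (w / v) ^ n := by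
    rw [Real.exp_neg, inv_le_comm₀ (Real.exp_pos _) (by positivity), inv_div]
    exact h1
  have h3 : v ^ (p + n - 1) = v ^ (p - 1) * v ^ n := by
    rw [← Real.rpow_add_natCast hv.ne']; ring_nf
  calc v ^ (p - 1) * (Real.exp (-v) * Real.exp (-(w / v)))
      ≤ v ^ (p - 1) * (Real.exp (-v) * (n.factorial / (w / v) ^ n)) := by gcongr
    _ = n.factorial / w ^ n * (Real.exp (-v) * v ^ (p + n - 1)) := by
      rw [h3, div_pow]; field_simp

lemma integrableOn_besselInt_of_pos {p w : ℝ} (hp : 0 < p) (hw : 0 ≤ w) :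
    IntegrableOn (fun v : ℝ => v ^ (p - 1) * Real.exp (-v - w / v)) (Set.Ioi 0) := by
  rcases hw.eq_or_lt with rfl | hw
  · simpa [mul_comm] using Real.GammaIntegral_convergent hp
  · exact integrableOn_besselInt p hw

lemma besselInt_zero {p : ℝ} (hp : 0 < p) : besselInt p 0 = Real.Gamma p := by
  simp [besselInt, Real.Gamma_eq_integral hp, mul_comm]

lemma besselInt_pos (p : ℝ) {w : ℝ} (hw : 0 < w) : 0 < besselInt p w := by
  refine (setIntegral_pos_iff_support_of_nonneg_ae ?_ (integrableOn_besselInt p hw)).2 ?_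
  · refine (ae_restrict_iff' measurableSet_Ioi).2 (Eventually.of_forall fun v hv => ?_)
    have hv : 0 < v := hv
    exact (by positivity : 0 ≤ v ^ (p - 1) * Real.exp (-v - w / v))
  · have : Set.Ioi (0 : ℝ) ⊆
        (Function.support fun v : ℝ => v ^ (p - 1) * Real.exp (-v - w / v)) ∩ Set.Ioi 0 := by
      intro v hv
      have hv' : 0 < v := hv
      exact ⟨(by positivity : v ^ (p - 1) * Real.exp (-v - w / v) ≠ 0), hv⟩
    exact lt_of_lt_of_le (by simp) (measure_mono this)

lemma besselInt_le_besselInt (p : ℝ) {w w' : ℝ} (hw : 0 < w) (h : w ≤ w') :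
    besselInt p w' ≤ besselInt p w := by
  refine setIntegral_mono_on (integrableOn_besselInt p (hw.trans_le h))
    (integrableOn_besselInt p hw) measurableSet_Ioi fun v hv => ?_
  have hv : 0 < v := hv
  gcongr

lemma besselInt_le_Gamma {p w : ℝ} (hp : 0 < p) (hw : 0 ≤ w) :
    besselInt p w ≤ Real.Gamma p := by
  rw [← besselInt_zero hp]
  refine setIntegral_mono_on (integrableOn_besselInt_of_pos hp hw)
    (integrableOn_besselInt_of_pos hp le_rfl) measurableSet_Ioi fun v hv => ?_
  have hv : 0 < v := hv
  gcongr

/-- The singularity at `w = 0` is at most a power: `exp(-w/v) ≤ (v/w)^ε` for `0 ≤ ε ≤ 1`. -/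
lemma besselInt_le_rpow {p w ε : ℝ} (hw : 0 < w) (hε : 0 ≤ ε) (hε1 : ε ≤ 1) (hp : 0 < p + ε) :
    besselInt p w ≤ Real.Gamma (p + ε) * w ^ (-ε) := by
  rw [Real.Gamma_eq_integral hp, ← integral_mul_const]
  refine setIntegral_mono_on (integrableOn_besselInt p hw)
    ((Real.GammaIntegral_convergent hp).mul_const _) measurableSet_Ioi fun v hv => ?_
  have hv : 0 < v := hv
  have hy : 0 < w / v := by positivity
  have h1 : (w / v) ^ ε ≤ Real.exp (w / v) := by
    rcases le_total (w / v) 1 with h | h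
    · exact (Real.rpow_le_one hy.le h hε).trans (Real.one_le_exp hy.le)
    · calc (w / v) ^ ε ≤ (w / v) ^ (1 : ℝ) := Real.rpow_le_rpow_of_exponent_le h hε1
        _ = w / v := Real.rpow_one _
        _ ≤ Real.exp (w / v) := by linarith [Real.add_one_le_exp (w / v)]
  have h2 : Real.exp (-(w / v)) ≤ (w / v) ^ (-ε) := by
    rw [Real.exp_neg, Real.rpow_neg hy.le]
    exact inv_anti₀ (by positivity) h1
  have h3 : v ^ (p + ε - 1) = v ^ (p - 1) * v ^ ε := by
    rw [← Real.rpow_add hv]; ring_nf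
  have h4 : (w / v) ^ (-ε) = w ^ (-ε) * v ^ ε := by
    rw [Real.div_rpow hw.le hv.le, Real.rpow_neg hv.le, div_inv_eq_mul]
  rw [sub_eq_add_neg (-v), Real.exp_add, h3]
  calc v ^ (p - 1) * (Real.exp (-v) * Real.exp (-(w / v)))
      ≤ v ^ (p - 1) * (Real.exp (-v) * (w / v) ^ (-ε)) := by gcongr
    _ = _ := by rw [h4]; ring

lemma tendsto_besselInt_zero {p : ℝ} (hp : 0 < p) :
    Tendsto (besselInt p) (𝓝[>] 0) (𝓝 (Real.Gamma p)) := by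
  rw [← besselInt_zero hp]
  refine tendsto_integral_filter_of_dominated_convergence
    (fun v => v ^ (p - 1) * Real.exp (-v - 0 / v))
    (Eventually.of_forall fun w => (measurable_besselInt_integrand p w).aestronglyMeasurable)
    ?_ (integrableOn_besselInt_of_pos hp le_rfl) ?_
  · filter_upwards [self_mem_nhdsWithin] with w hw
    have hw : 0 < w := hw
    refine (ae_restrict_iff' measurableSet_Ioi).2 (Eventually.of_forall fun v hv => ?_)
    have hv : 0 < v := hv
    rw [Real.norm_of_nonneg (by positivity)]
    gcongr
  · refine Eventually.of_forall fun v => ?_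
    have : Continuous fun w : ℝ => v ^ (p - 1) * Real.exp (-v - w / v) := by fun_prop
    exact (this.tendsto 0).mono_left nhdsWithin_le_nhds

/-- The substitution `v = b exp t` turns `besselInt` into the integral that defines `besselK`. -/
lemma besselInt_sq (p : ℝ) {b : ℝ} (hb : 0 < b) :
    besselInt p (b ^ 2) = b ^ p * (2 * besselK p (2 * b)) := by
  set F : ℝ → ℝ := fun t => Real.exp (-(2 * b) * Real.cosh t) * Real.exp (p * t) with hF
  have himg : (fun t : ℝ => b * Real.exp t) '' Set.univ = Set.Ioi 0 := by
    ext v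
    simp only [Set.image_univ, Set.mem_range, Set.mem_Ioi]
    refine ⟨fun ⟨t, ht⟩ => ht ▸ by positivity, fun hv => ⟨Real.log (v / b), ?_⟩⟩
    rw [Real.exp_log (by positivity)]
    field_simp
  have hder : ∀ t ∈ Set.univ, HasDerivWithinAt (fun t : ℝ => b * Real.exp t) (b * Real.exp t)
      Set.univ t := fun t _ => ((Real.hasDerivAt_exp t).const_mul b).hasDerivWithinAt
  have hinj : Set.InjOn (fun t : ℝ => b * Real.exp t) Set.univ := fun s _ t _ h => by
    simpa [hb.ne'] using h
  have hint : ∀ t : ℝ, |b * Real.exp t| • ((b * Real.exp t) ^ (p - 1) *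
      Real.exp (-(b * Real.exp t) - b ^ 2 / (b * Real.exp t))) = b ^ p * F t := by
    intro t
    have h1 : (b * Real.exp t) * (b * Real.exp t) ^ (p - 1) = b ^ p * Real.exp (p * t) := by
      rw [Real.rpow_sub_one (by positivity), mul_div_cancel₀ _ (by positivity),
        Real.mul_rpow hb.le (Real.exp_pos t).le, ← Real.exp_mul, mul_comm t p]
    have h2 : -(b * Real.exp t) - b ^ 2 / (b * Real.exp t) = -(2 * b) * Real.cosh t := by
      rw [Real.cosh_eq, Real.exp_neg]
      field_simp
      ring
    rw [abs_of_pos (by positivity), smul_eq_mul, ← mul_assoc, h1, h2]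
    simp only [hF]
    ring
  have hsub : besselInt p (b ^ 2) = b ^ p * ∫ t, F t := by
    rw [besselInt, ← himg, integral_image_eq_integral_abs_deriv_smul MeasurableSet.univ hder hinj,
      setIntegral_univ, ← integral_const_mul]
    exact integral_congr_ae (Eventually.of_forall hint)
  have hFi : Integrable F := by
    have h := integrableOn_besselInt p (by positivity : 0 < b ^ 2)
    rw [← himg, integrableOn_image_iff_integrableOn_abs_deriv_smul MeasurableSet.univ hder hinj,
      integrableOn_univ] at h
    simp_rw [hint] at h
    simpa [← mul_assoc, inv_mul_cancel₀ (Real.rpow_pos_of_pos hb p).ne'] using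
      h.const_mul (b ^ p)⁻¹
  have hsymm : ∫ t, F t = 2 * besselK p (2 * b) := by
    rw [besselK, ← integral_comp_abs
      (f := fun t => Real.exp (-(2 * b) * Real.cosh t) * Real.cosh (p * t))]
    have h1 : ∫ t, F t = ((∫ t, F t) + ∫ t, F (-t)) / 2 := by
      rw [integral_neg_eq_self F volume]; ring
    rw [h1, ← integral_add hFi hFi.comp_neg, ← integral_div]
    refine integral_congr_ae (Eventually.of_forall fun t => ?_)
    have h2 : Real.cosh (p * |t|) = Real.cosh (p * t) := by
      rcases abs_choice t with h | h <;> rw [h]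
      rw [mul_neg, Real.cosh_neg]
    simp only [hF, Real.cosh_abs, h2, Real.cosh_neg, Real.cosh_eq (p * t), mul_neg]
    ring
  rw [hsub, hsymm]

lemma besselK_neg (ν z : ℝ) : besselK (-ν) z = besselK ν z := by
  simp [besselK, Real.cosh_neg]

lemma gammaGammaPDF_comm (α β x : ℝ) : gammaGammaPDF α β x = gammaGammaPDF β α x := by
  rw [gammaGammaPDF, gammaGammaPDF, ← besselK_neg, neg_sub, mul_comm α β, add_comm α β,
    mul_comm (Real.Gamma α)]

lemma gammaGamma_comm (α β : ℝ) : gammaGamma α β = gammaGamma β α := by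
  simp only [gammaGamma, gammaGammaPDF_comm α β]

lemma gammaGammaPDF_of_pos {α β x : ℝ} (hα : 0 < α) (hβ : 0 < β) (hx : 0 < x) :
    gammaGammaPDF α β x = (α * β) ^ α / (Real.Gamma α * Real.Gamma β) * x ^ (α - 1)
      * besselInt (β - α) (α * β * x) := by
  have hk : 0 < α * β := by positivity
  have hkx : 0 < α * β * x := by positivity
  have h := besselInt_sq (β - α) (Real.sqrt_pos.2 hkx)
  rw [Real.sq_sqrt hkx.le, Real.sqrt_eq_rpow, ← Real.rpow_mul hkx.le,
    Real.mul_rpow hk.le hx.le] at h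
  rw [gammaGammaPDF, if_pos hx, ← besselK_neg, neg_sub, h, Real.sqrt_eq_rpow]
  have h1 : (α * β) ^ ((α + β) / 2) = (α * β) ^ α * (α * β) ^ (1 / 2 * (β - α)) := by
    rw [← Real.rpow_add hk]; ring_nf
  have h2 : x ^ ((α + β) / 2 - 1) = x ^ (α - 1) * x ^ (1 / 2 * (β - α)) := by
    rw [← Real.rpow_add hx]; ring_nf
  rw [h1, h2]
  ring

/-! ### The Gamma-Gamma distribution as the law of a product, and its moments -/

lemma measurable_gammaPDF (a r : ℝ) : Measurable (gammaPDF a r) :=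
  (measurable_gammaPDFReal a r).ennreal_ofReal

lemma gammaMeasure_ae_pos (a r : ℝ) : ∀ᵐ x ∂(gammaMeasure a r), 0 < x := by
  rw [gammaMeasure, ae_withDensity_iff (measurable_gammaPDF a r)]
  filter_upwards [Measure.ae_ne volume (0 : ℝ)] with x hx h
  by_contra hle
  exact h (gammaPDF_of_neg (lt_of_le_of_ne (not_lt.1 hle) hx))

/-- The density of a product of independent variables: if `V` has law `Γ(b, 1)` and `Y` has law
`Γ(a, k)`, then `x ↦ ∫ g_V(v) g_Y(x/v) dv/v` is the density of `V * Y`. -/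
lemma lintegral_gammaPDF_mul_gammaPDF_div {α β x : ℝ} (hα : 0 < α) (hβ : 0 < β) (hx : x ≠ 0) :
    ∫⁻ v, gammaPDF β 1 v * (ENNReal.ofReal |v⁻¹| * gammaPDF α (α * β) (v⁻¹ * x))
      = ENNReal.ofReal (gammaGammaPDF α β x) := by
  have hneg : ∀ v : ℝ, v ∉ Set.Ioi 0 →
      gammaPDF β 1 v * (ENNReal.ofReal |v⁻¹| * gammaPDF α (α * β) (v⁻¹ * x)) = 0 := by
    intro v hv
    rcases (not_lt.1 (Set.mem_Ioi.not.1 hv)).eq_or_lt with rfl | hv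
    · simp
    · simp [gammaPDF_of_neg hv]
  rw [← setLIntegral_eq_of_support_subset (s := Set.Ioi 0) (fun v hv => by
    by_contra h; exact hv (hneg v h))]
  rcases lt_or_gt_of_ne hx with hx | hx
  · rw [gammaGammaPDF, if_neg hx.not_gt, ENNReal.ofReal_zero]
    refine (setLIntegral_congr_fun measurableSet_Ioi fun v hv => ?_).trans lintegral_zero
    have hv : 0 < v := hv
    simp [gammaPDF_of_neg (mul_neg_of_pos_of_neg (inv_pos.2 hv) hx)]
  · rw [gammaGammaPDF_of_pos hα hβ hx, besselInt, ← integral_const_mul,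
      ofReal_integral_eq_lintegral_ofReal]
    · refine setLIntegral_congr_fun measurableSet_Ioi fun v hv => ?_
      have hv : 0 < v := hv
      have hk : 0 < α * β := by positivity
      have hΓα := Real.Gamma_pos_of_pos hα
      have hΓβ := Real.Gamma_pos_of_pos hβ
      rw [gammaPDF_of_nonneg hv.le, gammaPDF_of_nonneg (by positivity),
        ← ENNReal.ofReal_mul (abs_nonneg _), ← ENNReal.ofReal_mul (by positivity)]
      congr 1
      have h1 : (v⁻¹ * x) ^ (α - 1) = x ^ (α - 1) / v ^ (α - 1) := by
        rw [inv_mul_eq_div, Real.div_rpow hx.le hv.le]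
      have h2 : v ^ (β - α - 1) = v ^ (β - 1) / (v ^ (α - 1) * v) := by
        rw [← Real.rpow_add_one hv.ne', ← Real.rpow_sub hv]; ring_nf
      have h3 : Real.exp (-v - α * β * x / v)
          = Real.exp (-(1 * v)) * Real.exp (-(α * β * (v⁻¹ * x))) := by
        rw [← Real.exp_add]; congr 1; ring
      rw [h1, h2, h3, abs_of_pos (inv_pos.2 hv), Real.one_rpow]
      field_simp
    · exact (integrableOn_besselInt _ (by positivity)).const_mul _
    · refine (ae_restrict_iff' measurableSet_Ioi).2 (Eventually.of_forall fun v hv => ?_)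
      have hv : 0 < v := hv
      have hΓα := Real.Gamma_pos_of_pos hα
      have hΓβ := Real.Gamma_pos_of_pos hβ
      simp only [Pi.zero_apply]
      positivity

/-- The Gamma-Gamma distribution is the law of the product of two independent Gamma variables. -/
theorem gammaGamma_eq_map {α β : ℝ} (hα : 0 < α) (hβ : 0 < β) :
    gammaGamma α β
      = ((gammaMeasure β 1).prod (gammaMeasure α (α * β))).map (fun p : ℝ × ℝ => p.1 * p.2) := by
  have hk : 0 < α * β := by positivity
  have := isProbabilityMeasure_gammaMeasure hβ one_pos
  have := isProbabilityMeasure_gammaMeasure hα hk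
  ext s hs
  rw [gammaGamma, withDensity_apply _ hs, Measure.map_apply measurable_mul hs,
    Measure.prod_apply (measurable_mul hs)]
  have hmeas : Measurable fun v => gammaMeasure α (α * β)
      (Prod.mk v ⁻¹' ((fun p : ℝ × ℝ => p.1 * p.2) ⁻¹' s)) :=
    measurable_measure_prodMk_left (measurable_mul hs)
  rw [gammaMeasure.eq_1 β 1,
    lintegral_withDensity_eq_lintegral_mul _ (measurable_gammaPDF β 1) hmeas]
  have hmeas2 : Measurable (Function.uncurry fun (v x : ℝ) =>
      gammaPDF β 1 v * (ENNReal.ofReal |v⁻¹| * gammaPDF α (α * β) (v⁻¹ * x))) := by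
    have := measurable_gammaPDF β 1
    have := measurable_gammaPDF α (α * β)
    unfold Function.uncurry
    fun_prop
  have hinner : ∀ᵐ v : ℝ, (gammaPDF β 1 * fun v => gammaMeasure α (α * β)
        (Prod.mk v ⁻¹' ((fun p : ℝ × ℝ => p.1 * p.2) ⁻¹' s))) v
      = ∫⁻ x in s, gammaPDF β 1 v * (ENNReal.ofReal |v⁻¹| * gammaPDF α (α * β) (v⁻¹ * x)) := by
    filter_upwards [Measure.ae_ne volume (0 : ℝ)] with v hv
    have hg : Measurable fun x => gammaPDF α (α * β) (v⁻¹ * x) :=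
      (measurable_gammaPDF α (α * β)).comp (measurable_const_mul _)
    have hsv : MeasurableSet ((fun y : ℝ => v * y) ⁻¹' s) := measurable_const_mul v hs
    have h1 : gammaMeasure α (α * β) ((fun y : ℝ => v * y) ⁻¹' s)
        = ∫⁻ x in s, ENNReal.ofReal |v⁻¹| * gammaPDF α (α * β) (v⁻¹ * x) := by
      rw [gammaMeasure, withDensity_apply _ hsv, lintegral_const_mul _ hg,
        ← smul_eq_mul (ENNReal.ofReal |v⁻¹|), ← lintegral_smul_measure, ← Measure.restrict_smul,
        ← Real.map_volume_mul_left hv, setLIntegral_map hs hg (measurable_const_mul v)]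
      simp [inv_mul_cancel_left₀ hv]
    rw [lintegral_const_mul _ (hg.const_mul _), ← h1]
    rfl
  rw [lintegral_congr_ae hinner, lintegral_lintegral_swap hmeas2.aemeasurable]
  refine lintegral_congr_ae (ae_restrict_of_ae ?_)
  filter_upwards [Measure.ae_ne volume (0 : ℝ)] with x hx
  exact (lintegral_gammaPDF_mul_gammaPDF_div hα hβ hx).symm

lemma isProbabilityMeasure_gammaGamma {α β : ℝ} (hα : 0 < α) (hβ : 0 < β) :
    IsProbabilityMeasure (gammaGamma α β) := by
  have := isProbabilityMeasure_gammaMeasure hβ one_pos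
  have := isProbabilityMeasure_gammaMeasure hα (by positivity : 0 < α * β)
  rw [gammaGamma_eq_map hα hβ]
  exact Measure.isProbabilityMeasure_map measurable_mul.aemeasurable

lemma gammaGamma_absolutelyContinuous (α β : ℝ) : gammaGamma α β ≪ volume :=
  withDensity_absolutelyContinuous _ _

lemma gammaGamma_ae_pos (α β : ℝ) : ∀ᵐ x ∂(gammaGamma α β), 0 < x := by
  rw [ae_iff, gammaGamma]
  simp only [not_lt]
  change (volume.withDensity _) (Set.Iic 0) = 0
  rw [withDensity_apply _ measurableSet_Iic]
  refine (setLIntegral_congr_fun measurableSet_Iic fun x hx => ?_).trans lintegral_zero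
  have hx : x ≤ 0 := hx
  simp [gammaGammaPDF, hx.not_gt]

lemma integrable_rpow_gammaMeasure {a r q : ℝ} (ha : 0 < a) (hr : 0 < r) (hq : 0 < a + q) :
    Integrable (fun x : ℝ => x ^ q) (gammaMeasure a r) := by
  rw [gammaMeasure, integrable_withDensity_iff_integrable_smul' (measurable_gammaPDF a r)
    (Eventually.of_forall fun x => ENNReal.ofReal_lt_top)]
  have h := (integrableOn_rpow_mul_exp_neg_mul_rpow (p := 1) (s := a + q - 1) (b := r)
    (by linarith) one_pos hr).const_mul (r ^ a / Real.Gamma a)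
  replace h := (integrable_indicator_iff measurableSet_Ioi).2 h
  refine h.congr ?_
  filter_upwards [Measure.ae_ne volume (0 : ℝ)] with x hx
  rw [gammaPDF, ENNReal.toReal_ofReal (gammaPDFReal_nonneg ha hr x), gammaPDFReal]
  by_cases h0 : 0 < x
  · rw [Set.indicator_of_mem (by exact h0), if_pos h0.le, smul_eq_mul, Real.rpow_one,
      show a + q - 1 = (a - 1) + q by ring, Real.rpow_add h0]
    ring_nf
  · rw [Set.indicator_of_notMem (by exact h0), if_neg, zero_smul]
    exact fun h => h0 (lt_of_le_of_ne h hx.symm)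

/-- The moment of order `s ∈ ℂ` of the Gamma distribution. -/
lemma integral_cpow_gammaMeasure {a r : ℝ} {s : ℂ} (ha : 0 < a) (hr : 0 < r)
    (hs : 0 < a + s.re) :
    ∫ x : ℝ, (x : ℂ) ^ s ∂(gammaMeasure a r)
      = (r : ℂ) ^ (-s) * (Complex.Gamma (a + s) / Complex.Gamma a) := by
  rw [gammaMeasure, integral_withDensity_eq_integral_toReal_smul (measurable_gammaPDF a r)
    (Eventually.of_forall fun x => ENNReal.ofReal_lt_top)]
  have h : ∀ᵐ x : ℝ, (gammaPDF a r x).toReal • (x : ℂ) ^ s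
      = (Set.Ioi 0).indicator (fun x : ℝ => ((r ^ a / Real.Gamma a : ℝ) : ℂ) *
          ((x : ℂ) ^ (a + s - 1) * Complex.exp (-(r * x)))) x := by
    filter_upwards [Measure.ae_ne volume (0 : ℝ)] with x hx
    rw [gammaPDF, ENNReal.toReal_ofReal (gammaPDFReal_nonneg ha hr x), gammaPDFReal]
    by_cases h0 : 0 < x
    · rw [Set.indicator_of_mem (by exact h0), if_pos h0.le, Complex.real_smul,
        show (a : ℂ) + s - 1 = ((a - 1 : ℝ) : ℂ) + s by push_cast; ring,
        Complex.cpow_add _ _ (by exact_mod_cast hx)]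
      push_cast [Complex.ofReal_cpow h0.le]
      ring
    · rw [Set.indicator_of_notMem (by exact h0), if_neg, zero_smul]
      exact fun h => h0 (lt_of_le_of_ne h hx.symm)
  have hr' : (r : ℂ) ≠ 0 := by exact_mod_cast hr.ne'
  rw [integral_congr_ae h, integral_indicator measurableSet_Ioi, integral_const_mul,
    Complex.integral_cpow_mul_exp_neg_mul_Ioi (by simpa using hs) hr]
  have h1 : (1 / (r : ℂ)) ^ ((a : ℂ) + s) = (r : ℂ) ^ (-s) * ((r : ℂ) ^ (a : ℂ))⁻¹ := by
    rw [one_div, Complex.inv_cpow _ _ (by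
      rw [Complex.arg_ofReal_of_nonneg hr.le]; exact Real.pi_pos.ne), ← Complex.cpow_neg,
      ← Complex.cpow_neg, ← Complex.cpow_add _ _ hr']
    ring_nf
  have h2 : (r : ℂ) ^ (a : ℂ) ≠ 0 := by simp [Complex.cpow_eq_zero_iff, hr']
  rw [h1]
  push_cast [Complex.ofReal_cpow hr.le, ← Complex.Gamma_ofReal]
  field_simp

lemma integrable_rpow_gammaGamma {α β q : ℝ} (hα : 0 < α) (hβ : 0 < β) (hqα : 0 < α + q)
    (hqβ : 0 < β + q) : Integrable (fun x : ℝ => x ^ q) (gammaGamma α β) := by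
  have hk : 0 < α * β := by positivity
  have := isProbabilityMeasure_gammaMeasure hβ one_pos
  have := isProbabilityMeasure_gammaMeasure hα hk
  rw [gammaGamma_eq_map hα hβ, integrable_map_measure (by fun_prop) (by fun_prop)]
  refine ((integrable_rpow_gammaMeasure hβ one_pos hqβ).mul_prod
    (integrable_rpow_gammaMeasure hα hk hqα)).congr ?_
  filter_upwards [Measure.quasiMeasurePreserving_fst.ae (gammaMeasure_ae_pos β 1),
    Measure.quasiMeasurePreserving_snd.ae (gammaMeasure_ae_pos α (α * β))] with p h1 h2
  simp [Real.mul_rpow h1.le h2.le]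

/-- The moment of order `s ∈ ℂ` of the Gamma-Gamma distribution. -/
lemma integral_cpow_gammaGamma {α β : ℝ} {s : ℂ} (hα : 0 < α) (hβ : 0 < β)
    (hsα : 0 < α + s.re) (hsβ : 0 < β + s.re) :
    ∫ x : ℝ, (x : ℂ) ^ s ∂(gammaGamma α β) = ((α * β : ℝ) : ℂ) ^ (-s) *
      (Complex.Gamma (α + s) / Complex.Gamma α * (Complex.Gamma (β + s) / Complex.Gamma β)) := by
  have hk : 0 < α * β := by positivity
  have := isProbabilityMeasure_gammaMeasure hβ one_pos
  have := isProbabilityMeasure_gammaMeasure hα hk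
  rw [gammaGamma_eq_map hα hβ, integral_map (by fun_prop)
    (Complex.measurable_ofReal.pow_const s).aestronglyMeasurable]
  have h : ∀ᵐ p ∂((gammaMeasure β 1).prod (gammaMeasure α (α * β))),
      ((p.1 * p.2 : ℝ) : ℂ) ^ s = (p.1 : ℂ) ^ s * (p.2 : ℂ) ^ s := by
    filter_upwards [Measure.quasiMeasurePreserving_fst.ae (gammaMeasure_ae_pos β 1),
      Measure.quasiMeasurePreserving_snd.ae (gammaMeasure_ae_pos α (α * β))] with p h1 h2
    rw [Complex.ofReal_mul, Complex.mul_cpow_ofReal_nonneg h1.le h2.le]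
  rw [integral_congr_ae h,
    integral_prod_mul (fun x : ℝ => (x : ℂ) ^ s) (fun x : ℝ => (x : ℂ) ^ s),
    integral_cpow_gammaMeasure hβ one_pos hsβ, integral_cpow_gammaMeasure hα hk hsα]
  simp only [Complex.ofReal_one, Complex.one_cpow]
  ring

/-! ### The distribution function of the Gamma-Gamma law near zero -/

lemma tendsto_const_mul_nhdsGT_zero {r : ℝ} (hr : 0 < r) :
    Tendsto (fun x : ℝ => r * x) (𝓝[>] 0) (𝓝[>] 0) := by
  refine tendsto_nhdsWithin_iff.2 ⟨?_, ?_⟩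
  · have : Continuous fun x : ℝ => r * x := by fun_prop
    simpa using (this.tendsto 0).mono_left nhdsWithin_le_nhds
  · filter_upwards [self_mem_nhdsWithin] with x hx
    exact mul_pos hr hx

lemma lintegral_Ioo_rpow {D q x : ℝ} (hD : 0 ≤ D) (hq : 0 < q) (hx : 0 < x) :
    ∫⁻ u in Set.Ioo 0 x, ENNReal.ofReal (D * u ^ (q - 1)) = ENNReal.ofReal (D * (x ^ q / q)) := by
  have hi : IntegrableOn (fun u : ℝ => D * u ^ (q - 1)) (Set.Ioo 0 x) :=
    (((intervalIntegrable_iff_integrableOn_Ioo_of_le hx.le).1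
      (intervalIntegral.intervalIntegrable_rpow' (by linarith)))).const_mul D
  rw [← ofReal_integral_eq_lintegral_ofReal hi]
  · rw [integral_const_mul, ← integral_Ioc_eq_integral_Ioo,
      ← intervalIntegral.integral_of_le hx.le, integral_rpow (Or.inl (by linarith))]
    simp [hq.ne']
  · refine (ae_restrict_iff' measurableSet_Ioo).2 (Eventually.of_forall fun u hu => ?_)
    have hu : 0 < u := hu.1
    simp only [Pi.zero_apply]
    positivity

lemma gammaGamma_Iio {α β : ℝ} (hα : 0 < α) (hβ : 0 < β) (x : ℝ) :
    gammaGamma α β (Set.Iio x) = ∫⁻ u in Set.Ioo 0 x, ENNReal.ofReal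
      ((α * β) ^ α / (Real.Gamma α * Real.Gamma β) * u ^ (α - 1)
        * besselInt (β - α) (α * β * u)) := by
  have h : gammaGamma α β (Set.Iio x) = gammaGamma α β (Set.Ioo 0 x) := by
    refine measure_congr ?_
    filter_upwards [gammaGamma_ae_pos α β] with u hu
    exact propext ⟨fun h => ⟨hu, h⟩, fun h => h.2⟩
  rw [h, gammaGamma, withDensity_apply _ measurableSet_Ioo]
  refine setLIntegral_congr_fun measurableSet_Ioo fun u hu => ?_
  rw [gammaGammaPDF_of_pos hα hβ hu.1]

lemma le_gammaGamma_Iio {α β x : ℝ} (hα : 0 < α) (hβ : 0 < β) (hx : 0 < x) :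
    (α * β) ^ α / (Real.Gamma α * Real.Gamma β) * besselInt (β - α) (α * β * x) * (x ^ α / α)
      ≤ (gammaGamma α β).real (Set.Iio x) := by
  have := isProbabilityMeasure_gammaGamma hα hβ
  have hΓα := Real.Gamma_pos_of_pos hα
  have hΓβ := Real.Gamma_pos_of_pos hβ
  have hB := besselInt_pos (β - α) (by positivity : 0 < α * β * x)
  rw [measureReal_def, ← ENNReal.ofReal_le_iff_le_toReal (measure_ne_top _ _),
    ← lintegral_Ioo_rpow (by positivity) hα hx, gammaGamma_Iio hα hβ]
  refine setLIntegral_mono' measurableSet_Ioo fun u hu => ENNReal.ofReal_le_ofReal ?_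
  have hu0 : 0 < u := hu.1
  rw [mul_right_comm]
  gcongr
  exact besselInt_le_besselInt _ (by positivity) (by gcongr; exact hu.2.le)

lemma gammaGamma_Iio_le {α β x B ε : ℝ} (hα : 0 < α) (hβ : 0 < β) (hx : 0 < x) (hB0 : 0 ≤ B)
    (hε : ε < α) (hB : ∀ u, 0 < u → besselInt (β - α) (α * β * u) ≤ B * u ^ (-ε)) :
    (gammaGamma α β).real (Set.Iio x)
      ≤ (α * β) ^ α / (Real.Gamma α * Real.Gamma β) * B * (x ^ (α - ε) / (α - ε)) := by
  have hΓα := Real.Gamma_pos_of_pos hα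
  have hΓβ := Real.Gamma_pos_of_pos hβ
  have hαε : 0 < α - ε := by linarith
  refine ENNReal.toReal_le_of_le_ofReal (by positivity) ?_
  rw [← lintegral_Ioo_rpow (by positivity) hαε hx, gammaGamma_Iio hα hβ]
  refine setLIntegral_mono' measurableSet_Ioo fun u hu => ENNReal.ofReal_le_ofReal ?_
  have hu0 : 0 < u := hu.1
  calc _ ≤ (α * β) ^ α / (Real.Gamma α * Real.Gamma β) * u ^ (α - 1) * (B * u ^ (-ε)) := by
        gcongr; exact hB u hu0
    _ = _ := by
      rw [show α - ε - 1 = (α - 1) + -ε by ring, Real.rpow_add hu0]; ring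

/-- For `α < β` the density at `0` behaves as a multiple of `x^(α-1)`; the monotonicity of
`besselInt` transfers this to the distribution function. -/
lemma tendsto_gammaGamma_Iio_div_rpow {α β : ℝ} (hα : 0 < α) (hαβ : α < β) :
    Tendsto (fun x => (gammaGamma α β).real (Set.Iio x) / x ^ α) (𝓝[>] 0)
      (𝓝 ((α * β) ^ α / (Real.Gamma α * Real.Gamma β) * Real.Gamma (β - α) / α)) := by
  have hβ : 0 < β := hα.trans hαβ
  have hp : 0 < β - α := by linarith
  have hk : 0 < α * β := by positivity
  have hmul := tendsto_const_mul_nhdsGT_zero hk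
  have hlow := (((tendsto_besselInt_zero hp).comp hmul).const_mul
    ((α * β) ^ α / (Real.Gamma α * Real.Gamma β))).div_const α
  refine tendsto_of_tendsto_of_tendsto_of_le_of_le' hlow tendsto_const_nhds ?_ ?_
  · filter_upwards [self_mem_nhdsWithin] with x hx
    have hx : 0 < x := hx
    rw [le_div_iff₀ (by positivity)]
    refine le_trans (le_of_eq ?_) (le_gammaGamma_Iio hα hβ hx)
    simp only [Function.comp_apply]
    ring
  · filter_upwards [self_mem_nhdsWithin] with x hx
    have hx : 0 < x := hx
    rw [div_le_iff₀ (by positivity)]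
    refine (gammaGamma_Iio_le hα hβ hx (Real.Gamma_pos_of_pos hp).le hα fun u hu => ?_).trans
      (le_of_eq ?_)
    · simpa using besselInt_le_Gamma hp (by positivity : 0 ≤ α * β * u)
    · rw [sub_zero]; ring

lemma F₁_comm (α β x : ℝ) : F₁ α β x = F₁ β α x := by
  rw [F₁, F₁, mul_comm (Real.Gamma α), add_comm]

/-- For `α < β` the term of order `x^α` dominates in `F₁`. -/
lemma tendsto_F₁_div_rpow {α β : ℝ} (hα : 0 < α) (hαβ : α < β) :
    Tendsto (fun x => F₁ α β (α * β * x) / x ^ α) (𝓝[>] 0)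
      (𝓝 ((α * β) ^ α / (Real.Gamma α * Real.Gamma β) * Real.Gamma (β - α) / α)) := by
  have hβ : 0 < β := hα.trans hαβ
  have hp : 0 < β - α := by linarith
  have hk : 0 < α * β := by positivity
  have h0 : Tendsto (fun x : ℝ => x ^ (β - α)) (𝓝[>] 0) (𝓝 0) := by
    have := (Real.continuousAt_rpow_const 0 (β - α) (Or.inr hp.le)).tendsto
    rw [Real.zero_rpow hp.ne'] at this
    exact this.mono_left nhdsWithin_le_nhds
  have h1 := (h0.const_mul (1 / (Real.Gamma α * Real.Gamma β) *
    (Real.Gamma (α - β) / β * (α * β) ^ β))).const_add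
    ((α * β) ^ α / (Real.Gamma α * Real.Gamma β) * Real.Gamma (β - α) / α)
  rw [mul_zero, add_zero] at h1
  refine h1.congr' ?_
  filter_upwards [self_mem_nhdsWithin] with x hx
  have hx : 0 < x := hx
  rw [F₁, Real.mul_rpow hk.le hx.le, Real.mul_rpow hk.le hx.le, Real.rpow_sub hx]
  field_simp

lemma gammaGamma_Iio_isEquivalent_F₁ {α β : ℝ} (hα : 0 < α) (hβ : 0 < β) (hne : α ≠ β) :
    (fun x => (gammaGamma α β).real (Set.Iio x)) ~[𝓝[>] 0] (fun x => F₁ α β (α * β * x)) := by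
  wlog hαβ : α < β generalizing α β
  · have := this hβ hα hne.symm (lt_of_le_of_ne (not_lt.1 hαβ) hne.symm)
    simpa only [gammaGamma_comm β α, F₁_comm β α, mul_comm β α] using this
  have hp : 0 < β - α := by linarith
  have hΓα := Real.Gamma_pos_of_pos hα
  have hΓβ := Real.Gamma_pos_of_pos hβ
  have hΓ := Real.Gamma_pos_of_pos hp
  have hC : (α * β) ^ α / (Real.Gamma α * Real.Gamma β) * Real.Gamma (β - α) / α ≠ 0 := by
    positivity
  have h1 := tendsto_gammaGamma_Iio_div_rpow hα hαβ
  have h2 := tendsto_F₁_div_rpow hα hαβ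
  have h3 := h1.div h2 hC
  rw [div_self hC] at h3
  refine (isEquivalent_iff_tendsto_one ?_).2 (h3.congr' ?_)
  · filter_upwards [h2.eventually_ne hC] with x hx h
    simp [h] at hx
  · filter_upwards [self_mem_nhdsWithin] with x hx
    have hx : 0 < x ^ α := Real.rpow_pos_of_pos hx _
    simp only [Pi.div_apply]
    rw [div_div_div_cancel_right₀ hx.ne']

/-- Dilating the argument multiplies the distribution function by a bounded factor near zero. -/
lemma gammaGamma_Iio_mul_isBigO {α β r : ℝ} (hα : 0 < α) (hβ : 0 < β) (hne : α ≠ β)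
    (hr : 0 < r) :
    (fun x => (gammaGamma α β).real (Set.Iio (r * x))) =O[𝓝[>] 0]
      (fun x => (gammaGamma α β).real (Set.Iio x)) := by
  wlog hαβ : α < β generalizing α β
  · have := this hβ hα hne.symm (lt_of_le_of_ne (not_lt.1 hαβ) hne.symm)
    simpa only [gammaGamma_comm β α] using this
  have hp : 0 < β - α := by linarith
  have hΓα := Real.Gamma_pos_of_pos hα
  have hΓβ := Real.Gamma_pos_of_pos hβ
  have hΓ := Real.Gamma_pos_of_pos hp
  have hC : (α * β) ^ α / (Real.Gamma α * Real.Gamma β) * Real.Gamma (β - α) / α ≠ 0 := by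
    positivity
  have h1 := tendsto_gammaGamma_Iio_div_rpow hα hαβ
  have h2 := ((h1.comp (tendsto_const_mul_nhdsGT_zero hr)).div h1 hC).const_mul (r ^ α)
  refine isBigO_of_div_tendsto_nhds ?_ _ (h2.congr' ?_)
  · filter_upwards [h1.eventually_ne hC] with x hx h
    simp [h] at hx
  · filter_upwards [self_mem_nhdsWithin] with x hx
    have hx : 0 < x := hx
    have hx' : 0 < x ^ α := Real.rpow_pos_of_pos hx _
    have hr' : 0 < r ^ α := Real.rpow_pos_of_pos hr _
    simp only [Pi.div_apply, Function.comp_apply]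
    rw [Real.mul_rpow hr.le hx.le]
    field_simp

lemma exists_mul_rpow_le_gammaGamma_Iio {α β : ℝ} (hα : 0 < α) (hβ : 0 < β) :
    ∃ c > 0, ∀ x, 0 < x → x ≤ 1 → c * x ^ min α β ≤ (gammaGamma α β).real (Set.Iio x) := by
  wlog hαβ : α ≤ β generalizing α β
  · simpa only [gammaGamma_comm β α, min_comm β α] using this hβ hα (not_le.1 hαβ).le
  have hΓα := Real.Gamma_pos_of_pos hα
  have hΓβ := Real.Gamma_pos_of_pos hβ
  have hB := besselInt_pos (β - α) (by positivity : 0 < α * β)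
  refine ⟨(α * β) ^ α / (Real.Gamma α * Real.Gamma β) * besselInt (β - α) (α * β) / α,
    by positivity, fun x hx hx1 => ?_⟩
  rw [min_eq_left hαβ]
  refine le_trans ?_ (le_gammaGamma_Iio hα hβ hx)
  have h : besselInt (β - α) (α * β) ≤ besselInt (β - α) (α * β * x) :=
    besselInt_le_besselInt _ (by positivity) (mul_le_of_le_one_right (by positivity) hx1)
  rw [div_mul_eq_mul_div, mul_div_assoc]
  gcongr

lemma exists_gammaGamma_Iio_le_mul_rpow {α β ε : ℝ} (hα : 0 < α) (hβ : 0 < β) (hε : 0 < ε)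
    (hε1 : ε ≤ 1) (hεm : ε < min α β) :
    ∃ C > 0, ∀ x, 0 < x → (gammaGamma α β).real (Set.Iio x) ≤ C * x ^ (min α β - ε) := by
  wlog hαβ : α ≤ β generalizing α β
  · simpa only [gammaGamma_comm β α, min_comm β α] using
      this hβ hα (by rwa [min_comm]) (not_le.1 hαβ).le
  rw [min_eq_left hαβ] at hεm ⊢
  have hΓα := Real.Gamma_pos_of_pos hα
  have hΓβ := Real.Gamma_pos_of_pos hβ
  have hpε : 0 < β - α + ε := by linarith
  have hΓ := Real.Gamma_pos_of_pos hpε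
  have hk : 0 < α * β := by positivity
  have hαε : 0 < α - ε := by linarith
  refine ⟨(α * β) ^ α / (Real.Gamma α * Real.Gamma β) *
    (Real.Gamma (β - α + ε) * (α * β) ^ (-ε)) / (α - ε), by positivity, fun x hx => ?_⟩
  refine (gammaGamma_Iio_le hα hβ hx (B := Real.Gamma (β - α + ε) * (α * β) ^ (-ε))
    (by positivity) hεm fun u hu => ?_).trans (le_of_eq ?_)
  · refine (besselInt_le_rpow (by positivity) hε.le hε1 hpε).trans (le_of_eq ?_)
    rw [Real.mul_rpow hk.le hu.le, mul_assoc]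
  · ring

/-! ### Mellin transforms of tail functions -/

/-- The tail function `t ↦ P(W ≥ t)` of a positive random variable with `E W^σ < ∞` has the
Mellin transform `E W^s / s` on the line `Re s = σ`. -/
lemma mellin_tail {ρ : Measure ℝ} [IsProbabilityMeasure ρ] (hpos : ∀ᵐ w ∂ρ, 0 < w) {σ : ℝ}
    (hσ : 0 < σ) (hint : Integrable (fun w : ℝ => w ^ σ) ρ) {s : ℂ} (hs : s.re = σ) :
    MellinConvergent (fun t => ((ρ.real (Set.Ici t) : ℝ) : ℂ)) s ∧
      mellin (fun t => ((ρ.real (Set.Ici t) : ℝ) : ℂ)) s = (∫ w : ℝ, (w : ℂ) ^ s ∂ρ) / s := by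
  have hs0 : s ≠ 0 := by rintro rfl; simp at hs; linarith
  set H : ℝ → ℝ → ℂ := fun w => (Set.Iic w).indicator fun t : ℝ => (t : ℂ) ^ (s - 1) with hH
  have hHmeas : Measurable (Function.uncurry H) := by
    have h1 : MeasurableSet {p : ℝ × ℝ | p.2 ≤ p.1} := measurableSet_le measurable_snd measurable_fst
    have h2 : Measurable fun p : ℝ × ℝ => ((p.2 : ℝ) : ℂ) ^ (s - 1) :=
      (Complex.measurable_ofReal.comp measurable_snd).pow_const _
    exact h2.indicator h1
  have hset : ∀ w : ℝ, Set.Ioi (0 : ℝ) ∩ Set.Iic w = Set.Ioc 0 w := fun w => Set.Ioi_inter_Iic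
  have hHint : ∀ w : ℝ, 0 < w → Integrable (H w) (volume.restrict (Set.Ioi 0)) ∧
      (∫ t in Set.Ioi 0, H w t = (w : ℂ) ^ s / s) ∧ ∫ t in Set.Ioi 0, ‖H w t‖ = w ^ σ / σ := by
    intro w hw
    have hii : IntegrableOn (fun t : ℝ => (t : ℂ) ^ (s - 1)) (Set.Ioc 0 w) :=
      (intervalIntegrable_iff_integrableOn_Ioc_of_le hw.le).1
        (intervalIntegral.intervalIntegrable_cpow' (by simp; linarith))
    refine ⟨?_, ?_, ?_⟩
    · rw [hH, integrable_indicator_iff measurableSet_Iic, IntegrableOn,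
        Measure.restrict_restrict measurableSet_Iic, Set.inter_comm, hset]
      exact hii
    · rw [hH, setIntegral_indicator measurableSet_Iic, hset,
        ← intervalIntegral.integral_of_le hw.le, integral_cpow (Or.inl (by simp; linarith))]
      simp [hs0]
    · simp_rw [hH, norm_indicator_eq_indicator_norm]
      rw [setIntegral_indicator measurableSet_Iic, hset]
      have h : ∀ t ∈ Set.Ioc 0 w, ‖(t : ℂ) ^ (s - 1)‖ = t ^ (σ - 1) := fun t ht => by
        rw [Complex.norm_cpow_eq_rpow_re_of_pos ht.1]; simp [hs]
      rw [setIntegral_congr_fun measurableSet_Ioc h, ← intervalIntegral.integral_of_le hw.le,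
        integral_rpow (Or.inl (by linarith))]
      simp [hσ.ne']
  have hprod : Integrable (Function.uncurry H) (ρ.prod (volume.restrict (Set.Ioi 0))) := by
    rw [integrable_prod_iff hHmeas.aestronglyMeasurable]
    refine ⟨hpos.mono fun w hw => (hHint w hw).1, (hint.div_const σ).congr ?_⟩
    filter_upwards [hpos] with w hw
    exact (hHint w hw).2.2.symm
  have htail : ∀ t : ℝ, ∫ w, H w t ∂ρ = (t : ℂ) ^ (s - 1) * ((ρ.real (Set.Ici t) : ℝ) : ℂ) := by
    intro t
    have : (fun w => H w t) = (Set.Ici t).indicator fun _ => (t : ℂ) ^ (s - 1) := by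
      ext w
      by_cases h : t ≤ w
      · simp [hH, h]
      · simp [hH, h]
    rw [this, integral_indicator_const _ measurableSet_Ici, Complex.real_smul, mul_comm]
  constructor
  · rw [MellinConvergent]
    have := hprod.integral_prod_right
    simp only [Function.uncurry_apply_pair, htail] at this
    exact this
  · rw [mellin]
    simp only [smul_eq_mul, ← htail]
    rw [← integral_integral_swap hprod, ← integral_div]
    refine integral_congr_ae ?_
    filter_upwards [hpos] with w hw
    exact (hHint w hw).2.1

lemma continuousAt_tail {ρ : Measure ℝ} [IsProbabilityMeasure ρ] {x : ℝ} (hx : ρ {x} = 0) :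
    ContinuousAt (fun t => ρ.real (Set.Ici t)) x := by
  have h : Tendsto (fun t => ρ (Set.Ici t)) (𝓝 x) (𝓝 (ρ (Set.Ici x))) := by
    refine tendsto_measure_of_ae_tendsto_indicator_of_isFiniteMeasure (𝓝 x) measurableSet_Ici
      (fun _ => measurableSet_Ici) ?_
    have hne : ∀ᵐ w ∂ρ, w ≠ x := by simpa [ae_iff] using hx
    filter_upwards [hne] with w hw
    rcases lt_or_gt_of_ne hw with hw | hw
    · filter_upwards [lt_mem_nhds hw] with t ht
      simp [ht.not_ge, hw.not_ge]
    · filter_upwards [gt_mem_nhds hw] with t ht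
      simp [ht.le, hw.le]
  exact (ENNReal.tendsto_toReal (measure_ne_top _ _)).comp h

/-! ### Decay of the Gamma function along vertical lines -/

lemma norm_Gamma_le {z : ℂ} (hz : 0 < z.re) : ‖Complex.Gamma z‖ ≤ Real.Gamma z.re := by
  rw [Complex.Gamma_eq_integral hz, Complex.GammaIntegral, Real.Gamma_eq_integral hz]
  refine (norm_integral_le_integral_norm _).trans (le_of_eq ?_)
  refine setIntegral_congr_fun measurableSet_Ioi fun t ht => ?_
  have ht : 0 < t := ht
  simp [Complex.norm_cpow_eq_rpow_re_of_pos ht, Complex.norm_exp]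

lemma norm_Gamma_le_div {z : ℂ} (hz : 0 < z.re) :
    ‖Complex.Gamma z‖ ≤ Real.Gamma (z.re + 1) / ‖z‖ := by
  have hz0 : z ≠ 0 := by rintro rfl; simp at hz
  rw [le_div_iff₀ (norm_pos_iff.2 hz0), mul_comm, ← norm_mul, ← Complex.Gamma_add_one z hz0]
  simpa using norm_Gamma_le (z := z + 1) (by simp; linarith)

/-- The moment of order `s` of the quotient of two independent Gamma-Gamma variables, up to the
normalizing constant `Γ(α)² Γ(β)²`. -/
noncomputable def quotMoment (α β : ℝ) (s : ℂ) : ℂ :=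
  Complex.Gamma (α - s) * Complex.Gamma (β - s) * (Complex.Gamma (α + s) * Complex.Gamma (β + s))

/-- On the line `Re s = σ` the factors `1 / s` and `Γ(β + s)` both decay like `|Im s|⁻¹`, and the
other three Gamma factors are bounded. -/
lemma integrable_quotMoment_div {α β σ : ℝ} (hσ : 0 < σ) (hσα : σ < α) (hσβ : σ < β) :
    Integrable fun t : ℝ => quotMoment α β (σ + t * Complex.I) / (σ + t * Complex.I) := by
  have hα : 0 < α := hσ.trans hσα
  have hβ : 0 < β := hσ.trans hσβ
  have hre : ∀ t : ℝ, ((σ : ℂ) + t * Complex.I).re = σ := fun t => by simp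
  have hne : ∀ t : ℝ, (σ : ℂ) + t * Complex.I ≠ 0 := fun t h => by
    have := hre t; rw [h] at this; simp at this; linarith
  have hdiff : ∀ z : ℂ, 0 < z.re → ContinuousAt Complex.Gamma z := fun z hz =>
    (Complex.differentiableAt_Gamma z fun m h => by
      rw [h] at hz; simp at hz; linarith [(Nat.cast_nonneg m : (0 : ℝ) ≤ m)]).continuousAt
  have hcont : Continuous fun t : ℝ =>
      quotMoment α β (σ + t * Complex.I) / (σ + t * Complex.I) := by
    refine Continuous.div ?_ (by fun_prop) hne
    simp only [quotMoment]
    refine continuous_iff_continuousAt.2 fun t => ?_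
    refine ContinuousAt.mul (ContinuousAt.mul ?_ ?_) (ContinuousAt.mul ?_ ?_)
    all_goals
      refine ContinuousAt.comp (g := Complex.Gamma) (hdiff _ ?_) (by fun_prop)
      simp
      linarith
  set K : ℝ := Real.Gamma (α - σ) * Real.Gamma (β - σ) *
    (Real.Gamma (α + σ) * Real.Gamma (β + σ + 1)) with hK
  have hg1 := Real.Gamma_pos_of_pos (by linarith : 0 < α - σ)
  have hg2 := Real.Gamma_pos_of_pos (by linarith : 0 < β - σ)
  have hg3 := Real.Gamma_pos_of_pos (by linarith : 0 < α + σ)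
  have hg4 := Real.Gamma_pos_of_pos (by linarith : 0 < β + σ + 1)
  have hsc : Integrable fun t : ℝ => K * (σ ^ 2)⁻¹ * (1 + (t / σ) ^ 2)⁻¹ :=
    ((integrable_inv_one_add_sq).comp_div hσ.ne').const_mul _
  refine hsc.mono' hcont.aestronglyMeasurable (Eventually.of_forall fun t => ?_)
  set z : ℂ := σ + t * Complex.I with hz
  have hzre : z.re = σ := hre t
  have hzn : ‖z‖ ^ 2 = σ ^ 2 * (1 + (t / σ) ^ 2) := by
    rw [← Complex.normSq_eq_norm_sq, Complex.normSq_apply, hzre]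
    simp only [hz, Complex.add_im, Complex.ofReal_im, Complex.mul_im, Complex.I_re, Complex.I_im,
      Complex.ofReal_re]
    field_simp
    ring
  have hz0 : 0 < ‖z‖ := norm_pos_iff.2 (hne t)
  have hle : ‖z‖ ≤ ‖(β : ℂ) + z‖ := by
    refine (sq_le_sq₀ (norm_nonneg _) (norm_nonneg _)).1 ?_
    rw [← Complex.normSq_eq_norm_sq, ← Complex.normSq_eq_norm_sq, Complex.normSq_apply,
      Complex.normSq_apply]
    simp only [Complex.add_re, Complex.add_im, Complex.ofReal_re, Complex.ofReal_im, hzre]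
    nlinarith
  have h1 : ‖Complex.Gamma (α - z)‖ ≤ Real.Gamma (α - σ) := by
    simpa [hzre] using norm_Gamma_le (z := α - z) (by simp [hzre]; linarith)
  have h2 : ‖Complex.Gamma (β - z)‖ ≤ Real.Gamma (β - σ) := by
    simpa [hzre] using norm_Gamma_le (z := β - z) (by simp [hzre]; linarith)
  have h3 : ‖Complex.Gamma (α + z)‖ ≤ Real.Gamma (α + σ) := by
    simpa [hzre] using norm_Gamma_le (z := α + z) (by simp [hzre]; linarith)
  have h4 : ‖Complex.Gamma (β + z)‖ ≤ Real.Gamma (β + σ + 1) / ‖z‖ := by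
    refine (norm_Gamma_le_div (by simp [hzre]; linarith)).trans ?_
    simp only [Complex.add_re, Complex.ofReal_re, hzre]
    gcongr
  rw [quotMoment, norm_div, norm_mul, norm_mul, norm_mul]
  calc _ ≤ Real.Gamma (α - σ) * Real.Gamma (β - σ) *
        (Real.Gamma (α + σ) * (Real.Gamma (β + σ + 1) / ‖z‖)) / ‖z‖ := by gcongr
    _ = K * (‖z‖ ^ 2)⁻¹ := by rw [hK]; field_simp
    _ = _ := by rw [hzn, mul_inv]; ring

/-! ### The quotient of two independent Gamma-Gamma variables -/

/-- The integrand of `F₂` is `quotMoment α β s / s * x^s`: the factor `Γ(s) / Γ(1 + s)` is `1/s`. -/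
lemma meijerIntegrand_eq {α β x : ℝ} {s : ℂ} (hs : 0 < s.re) :
    meijerIntegrand 2 3 (upperParams α β) (lowerParams α β) x s
      = quotMoment α β s / s * (x : ℂ) ^ s := by
  have hs0 : s ≠ 0 := by rintro rfl; simp at hs
  have hΓ : Complex.Gamma s ≠ 0 := Complex.Gamma_ne_zero_of_re_pos hs
  have h : Complex.Gamma (1 + s) = s * Complex.Gamma s := by
    rw [add_comm, Complex.Gamma_add_one s hs0]
  simp only [meijerIntegrand, Fin.prod_univ_three, upperParams, lowerParams, quotMoment]
  simp [h]
  left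
  field_simp

lemma pos_and_lt_of_separates {α β σ : ℝ} (h : Separates σ 2 3 (upperParams α β) (lowerParams α β)) :
    0 < σ ∧ σ < α ∧ σ < β := by
  obtain ⟨h1, h2⟩ := h
  refine ⟨?_, ?_, ?_⟩
  · simpa [upperParams] using h2 2 (by decide)
  · simpa [lowerParams] using h1 0 (by decide)
  · simpa [lowerParams] using h1 1 (by decide)

variable {Ω : Type*} [MeasurableSpace Ω] {μ : Measure Ω} {α β : ℝ} {h₁ h₂ : Ω → ℝ}

lemma ae_pos_of_hasLaw (h : HasLaw h₁ (gammaGamma α β) μ) : ∀ᵐ ω ∂μ, 0 < h₁ ω := by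
  have := gammaGamma_ae_pos α β
  rw [← h.map_eq] at this
  exact ae_of_ae_map h.aemeasurable this

/-- The quotient of two independent Gamma-Gamma variables has no atoms on `(0, ∞)`. -/
lemma measure_div_eq_zero [IsProbabilityMeasure μ] (hα : 0 < α) (hβ : 0 < β)
    (hlaw₁ : HasLaw h₁ (gammaGamma α β) μ) (hlaw₂ : HasLaw h₂ (gammaGamma α β) μ)
    (hind : IndepFun h₁ h₂ μ) (x : ℝ) : μ {ω | h₁ ω / h₂ ω = x} = 0 := by
  have := isProbabilityMeasure_gammaGamma hα hβ
  have hprod := (indepFun_iff_map_prod_eq_prod_map_map hlaw₁.aemeasurable hlaw₂.aemeasurable).1 hind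
  rw [hlaw₁.map_eq, hlaw₂.map_eq] at hprod
  have hS : MeasurableSet {p : ℝ × ℝ | p.1 = x * p.2} :=
    measurableSet_eq_fun measurable_fst (measurable_snd.const_mul x)
  have h0 : ((gammaGamma α β).prod (gammaGamma α β)) {p : ℝ × ℝ | p.1 = x * p.2} = 0 := by
    rw [Measure.prod_apply_symm hS]
    refine (lintegral_congr fun y => ?_).trans lintegral_zero
    refine gammaGamma_absolutelyContinuous α β ?_
    have : (fun z : ℝ => (z, y)) ⁻¹' {p : ℝ × ℝ | p.1 = x * p.2} = {x * y} := by
      ext z; simp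
    rw [this, Real.volume_singleton]
  rw [← hprod, Measure.map_apply_of_aemeasurable
    (hlaw₁.aemeasurable.prodMk hlaw₂.aemeasurable) hS] at h0
  refine measure_mono_null_ae ?_ h0
  filter_upwards [ae_pos_of_hasLaw hlaw₂] with ω hω h
  have h : h₁ ω / h₂ ω = x := h
  exact (div_eq_iff hω.ne').1 h

/-- The distribution function of the quotient is `F₂`, by Mellin inversion of its tail. -/
theorem measureReal_div_le_eq_F₂ [IsProbabilityMeasure μ] (hα : 0 < α) (hβ : 0 < β)
    (hlaw₁ : HasLaw h₁ (gammaGamma α β) μ) (hlaw₂ : HasLaw h₂ (gammaGamma α β) μ)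
    (hind : IndepFun h₁ h₂ μ) {σ : ℝ}
    (hsep : Separates σ 2 3 (upperParams α β) (lowerParams α β)) {x : ℝ} (hx : 0 < x) :
    μ.real {ω | h₁ ω / h₂ ω ≤ x} = F₂ σ α β x := by
  obtain ⟨hσ, hσα, hσβ⟩ := pos_and_lt_of_separates hsep
  have hk : 0 < α * β := by positivity
  have hpos₁ := ae_pos_of_hasLaw hlaw₁
  have hpos₂ := ae_pos_of_hasLaw hlaw₂
  set W : Ω → ℝ := fun ω => h₂ ω / h₁ ω with hW
  have hWm : AEMeasurable W μ := hlaw₂.aemeasurable.div hlaw₁.aemeasurable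
  set ρ : Measure ℝ := μ.map W with hρ
  have : IsProbabilityMeasure ρ := Measure.isProbabilityMeasure_map hWm
  have hρpos : ∀ᵐ w ∂ρ, 0 < w := by
    rw [hρ, ae_map_iff hWm measurableSet_Ioi]
    filter_upwards [hpos₁, hpos₂] with ω ha hb
    exact div_pos hb ha
  have hρint : Integrable (fun w : ℝ => w ^ σ) ρ := by
    rw [hρ, integrable_map_measure (by fun_prop) hWm]
    have i1 : Integrable (fun ω => h₁ ω ^ (-σ)) μ := by
      have := integrable_rpow_gammaGamma (q := -σ) hα hβ (by linarith) (by linarith)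
      rw [← hlaw₁.map_eq] at this
      exact this.comp_aemeasurable hlaw₁.aemeasurable
    have i2 : Integrable (fun ω => h₂ ω ^ σ) μ := by
      have := integrable_rpow_gammaGamma (q := σ) hα hβ (by linarith) (by linarith)
      rw [← hlaw₂.map_eq] at this
      exact this.comp_aemeasurable hlaw₂.aemeasurable
    have hi : IndepFun (fun ω => h₂ ω ^ σ) (fun ω => h₁ ω ^ (-σ)) μ :=
      hind.symm.comp (φ := fun y : ℝ => y ^ σ) (ψ := fun y : ℝ => y ^ (-σ))
        (by fun_prop) (by fun_prop)
    refine (hi.integrable_mul i2 i1).congr ?_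
    filter_upwards [hpos₁, hpos₂] with ω ha hb
    simp only [Pi.mul_apply, Function.comp_apply, hW]
    rw [Real.div_rpow hb.le ha.le, Real.rpow_neg ha.le, div_eq_mul_inv]
  have hρmom : ∀ s : ℂ, s.re = σ → ∫ w : ℝ, (w : ℂ) ^ s ∂ρ
      = quotMoment α β s / ((Real.Gamma α ^ 2 * Real.Gamma β ^ 2 : ℝ) : ℂ) := by
    intro s hs
    have hm : ∀ q : ℂ, Measurable fun y : ℝ => (y : ℂ) ^ q := fun q =>
      Complex.measurable_ofReal.pow_const q
    have hk0 : ((α * β : ℝ) : ℂ) ≠ 0 := by exact_mod_cast hk.ne'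
    have hΓα : Complex.Gamma α ≠ 0 := Complex.Gamma_ne_zero_of_re_pos (by simpa using hα)
    have hΓβ : Complex.Gamma β ≠ 0 := Complex.Gamma_ne_zero_of_re_pos (by simpa using hβ)
    have hi : IndepFun (fun ω => (h₂ ω : ℂ) ^ s) (fun ω => (h₁ ω : ℂ) ^ (-s)) μ :=
      hind.symm.comp (hm s) (hm (-s))
    have e1 : ∫ ω, (h₁ ω : ℂ) ^ (-s) ∂μ = ∫ y : ℝ, (y : ℂ) ^ (-s) ∂(gammaGamma α β) := by
      rw [← hlaw₁.map_eq, integral_map hlaw₁.aemeasurable (hm _).aestronglyMeasurable]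
    have e2 : ∫ ω, (h₂ ω : ℂ) ^ s ∂μ = ∫ y : ℝ, (y : ℂ) ^ s ∂(gammaGamma α β) := by
      rw [← hlaw₂.map_eq, integral_map hlaw₂.aemeasurable (hm _).aestronglyMeasurable]
    have e3 : ∀ᵐ ω ∂μ, ((W ω : ℝ) : ℂ) ^ s = (h₂ ω : ℂ) ^ s * (h₁ ω : ℂ) ^ (-s) := by
      filter_upwards [hpos₁, hpos₂] with ω ha hb
      have hinv : ((h₁ ω : ℂ)⁻¹) ^ s = (h₁ ω : ℂ) ^ (-s) := by
        rw [Complex.inv_cpow _ _ (by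
          rw [Complex.arg_ofReal_of_nonneg ha.le]; exact Real.pi_pos.ne), Complex.cpow_neg]
      rw [← hinv, ← Complex.ofReal_inv, ← Complex.mul_cpow_ofReal_nonneg hb.le
        (inv_nonneg.2 ha.le), ← Complex.ofReal_mul, ← div_eq_mul_inv]
    rw [hρ, integral_map hWm (hm s).aestronglyMeasurable, integral_congr_ae e3,
      hi.integral_fun_mul_eq_mul_integral
        ((hm s).comp_aemeasurable hlaw₂.aemeasurable).aestronglyMeasurable
        ((hm (-s)).comp_aemeasurable hlaw₁.aemeasurable).aestronglyMeasurable, e1, e2,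
      integral_cpow_gammaGamma hα hβ (by rw [hs]; linarith) (by rw [hs]; linarith),
      integral_cpow_gammaGamma hα hβ (by simp [hs]; linarith) (by simp [hs]; linarith),
      neg_neg, Complex.cpow_neg, quotMoment, ← sub_eq_add_neg, ← sub_eq_add_neg]
    have hks : ((α * β : ℝ) : ℂ) ^ s ≠ 0 := fun h =>
      hk0 ((Complex.cpow_eq_zero_iff _ _).1 h).1
    push_cast [← Complex.Gamma_ofReal] at hks ⊢
    field_simp
  set f : ℝ → ℂ := fun t => ((ρ.real (Set.Ici t) : ℝ) : ℂ) with hf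
  have hmel : ∀ s : ℂ, s.re = σ → mellin f s
      = (Real.Gamma α ^ 2 * Real.Gamma β ^ 2 : ℂ)⁻¹ * (quotMoment α β s / s) := by
    intro s hs
    rw [(mellin_tail hρpos hσ hρint hs).2, hρmom s hs]
    push_cast
    ring
  have hre : ∀ t : ℝ, ((σ : ℂ) + t * Complex.I).re = σ := fun t => by simp
  have hvert : Complex.VerticalIntegrable (mellin f) σ := by
    refine ((integrable_quotMoment_div hσ hσα hσβ).const_mul
      (Real.Gamma α ^ 2 * Real.Gamma β ^ 2 : ℂ)⁻¹).congr (Eventually.of_forall fun t => ?_)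
    exact (hmel _ (hre t)).symm
  have hcont : ContinuousAt f x⁻¹ := by
    refine Complex.continuous_ofReal.continuousAt.comp (continuousAt_tail ?_)
    rw [hρ, Measure.map_apply_of_aemeasurable hWm (measurableSet_singleton _)]
    exact measure_div_eq_zero hα hβ hlaw₂ hlaw₁ hind.symm x⁻¹
  have hinv := mellinInv_mellin_eq σ f (inv_pos.2 hx)
    (mellin_tail hρpos hσ hρint (s := σ) (by simp)).1 hvert hcont
  have hleft : μ.real {ω | h₁ ω / h₂ ω ≤ x} = ρ.real (Set.Ici x⁻¹) := by
    rw [hρ, map_measureReal_apply_of_aemeasurable hWm measurableSet_Ici]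
    refine measureReal_congr ?_
    filter_upwards [hpos₁, hpos₂] with ω ha hb
    refine propext ?_
    change h₁ ω / h₂ ω ≤ x ↔ x⁻¹ ≤ h₂ ω / h₁ ω
    rw [inv_le_comm₀ hx (div_pos hb ha), inv_div]
  have hval : f x⁻¹ = (Real.Gamma α ^ 2 * Real.Gamma β ^ 2 : ℂ)⁻¹ *
      meijerG σ 2 3 (upperParams α β) (lowerParams α β) x := by
    have hI : ∀ t : ℝ, ((x⁻¹ : ℝ) : ℂ) ^ (-((σ : ℂ) + t * Complex.I)) •
        mellin f (σ + t * Complex.I) = (Real.Gamma α ^ 2 * Real.Gamma β ^ 2 : ℂ)⁻¹ *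
          meijerIntegrand 2 3 (upperParams α β) (lowerParams α β) x (σ + t * Complex.I) := by
      intro t
      have hz := hre t
      rw [hmel _ hz, meijerIntegrand_eq (by rw [hz]; exact hσ), Complex.ofReal_inv,
        Complex.inv_cpow _ _ (by
          rw [Complex.arg_ofReal_of_nonneg hx.le]; exact Real.pi_pos.ne), Complex.cpow_neg,
        inv_inv, smul_eq_mul]
      ring
    rw [← hinv, mellinInv, meijerG, integral_congr_ae (Eventually.of_forall hI),
      integral_const_mul, Complex.real_smul, mul_left_comm]
    push_cast
    rw [one_div]
  have hreal : ρ.real (Set.Ici x⁻¹) = (f x⁻¹).re := by simp [hf]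
  rw [hleft, hreal, hval, F₂, ← Complex.re_ofReal_mul]
  push_cast
  rw [one_div]

/-! ### Outage events of the dynamic scheme -/

lemma sicSuccess_nonneg (thr x y : ℝ) : 0 ≤ sicSuccess thr x y := by
  unfold sicSuccess; split_ifs <;> norm_num

lemma sicSuccess_le_one (thr x y : ℝ) : sicSuccess thr x y ≤ 1 := by
  unfold sicSuccess; split_ifs <;> norm_num

/-- Interference never helps: the SINR is at most the SNR. -/
lemma sinr₁_le (sic : SIC) (o : DecodingOrder) (t₂ : ℝ) {a b : ℝ} (ha : 0 ≤ a) (hb : 0 ≤ b) :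
    sinr₁ sic o t₂ a b ≤ a := by
  have h0 := sicSuccess_nonneg t₂ b a
  have h1 := sicSuccess_le_one t₂ b a
  cases o with
  | o12 => exact div_le_self ha (by linarith)
  | o21 =>
    cases sic with
    | perfect => exact le_rfl
    | imperfect => exact div_le_self ha (by nlinarith)
    | worstCase => exact mul_le_of_le_one_left ha h1

/-- If one of the two signals can be decoded first, then the optimal policy decodes such a signal
first, and BS₁ is in outage only if it would be without interference. -/
lemma lt_or_of_sinr₁_lt {sic : SIC} {o : ℝ → ℝ → DecodingOrder} {t₁ t₂ a b : ℝ}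
    (ho : IsOptimalPolicy t₁ t₂ o) (ha : 0 ≤ a) (hb : 0 ≤ b)
    (h : sinr₁ sic (o a b) t₂ a b < t₁) :
    a < t₁ ∨ (a < t₁ * (b + 1) ∧ b < t₂ * (a + 1)) := by
  rw [← div_lt_iff₀ (by linarith), ← div_lt_iff₀ (by linarith)]
  by_contra! hcon
  obtain ⟨hat, hcon⟩ := hcon
  obtain ⟨ho1, ho2⟩ := ho a b ha hb
  cases hoab : o a b with
  | o12 =>
    rw [hoab] at h ho2
    have h : a / (b + 1) < t₁ := h
    exact absurd (ho2 ⟨h, hcon h⟩) (by simp)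
  | o21 =>
    rw [hoab] at h ho1
    have hB : t₂ ≤ b / (a + 1) := by
      by_contra! hB
      rcases lt_or_ge (a / (b + 1)) t₁ with hA | hA
      · exact absurd (hcon hA) (not_le.2 hB)
      · exact absurd (ho1 ⟨hA, hB⟩) (by simp)
    have hs : sicSuccess t₂ b a = 1 := if_pos hB
    cases sic <;> simp [sinr₁, sinrSecond, hs] at h <;> linarith

/-- If neither signal can be decoded first and the interference cancellation is not perfect, then
BS₁ is in outage whatever the decoding order. -/
lemma sinr₁_lt_of_lt {sic : SIC} (hsic : sic ≠ .perfect) (o : DecodingOrder) {t₁ t₂ a b : ℝ}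
    (ht₁ : 0 < t₁) (ha : 0 ≤ a) (hb : 0 ≤ b) (hA : a < t₁ * (b + 1)) (hB : b < t₂ * (a + 1)) :
    sinr₁ sic o t₂ a b < t₁ := by
  rw [← div_lt_iff₀ (by linarith)] at hA hB
  have hs : sicSuccess t₂ b a = 0 := if_neg (not_le.2 hB)
  cases o with
  | o12 => exact hA
  | o21 =>
    cases sic with
    | perfect => exact absurd rfl hsic
    | imperfect => simpa [sinr₁, sinrSecond, hs] using hA
    | worstCase => simpa [sinr₁, sinrSecond, hs] using ht₁

/-- The decoding order with the roles of the two base stations exchanged. -/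
def DecodingOrder.swap : DecodingOrder → DecodingOrder
  | .o12 => .o21
  | .o21 => .o12

lemma IsOptimalPolicy.swap {t₁ t₂ : ℝ} {o : ℝ → ℝ → DecodingOrder}
    (ho : IsOptimalPolicy t₁ t₂ o) : IsOptimalPolicy t₂ t₁ fun a b => (o b a).swap := by
  intro a b ha hb
  obtain ⟨h1, h2⟩ := ho b a hb ha
  exact ⟨fun h => by simp [h2 ⟨h.2, h.1⟩, DecodingOrder.swap],
    fun h => by simp [h1 ⟨h.2, h.1⟩, DecodingOrder.swap]⟩

lemma outage₂_eq_outage₁_swap (μ : Measure Ω) (sic : SIC) (o : ℝ → ℝ → DecodingOrder)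
    (t₁ t₂ c₁ c₂ : ℝ) (h₁ h₂ : Ω → ℝ) :
    outage₂ μ sic o t₁ t₂ c₁ c₂ h₁ h₂
      = outage₁ μ sic (fun a b => (o b a).swap) t₂ t₁ c₂ c₁ h₂ h₁ := by
  funext γ
  have h : ∀ (d : DecodingOrder) (a b : ℝ), sinr₂ sic d t₁ a b = sinr₁ sic d.swap t₁ b a := by
    intro d a b
    cases d <;> rfl
  simp only [outage₂, outage₁, h]

lemma receivedSNR_nonneg {c γ : ℝ} (hc : 0 < c) (hγ : 0 < γ) (h : ℝ) :
    0 ≤ receivedSNR c γ h := by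
  unfold receivedSNR; positivity

lemma receivedSNR_lt_iff {c γ t h : ℝ} (hc : 0 < c) (hγ : 0 < γ) (hh : 0 < h) :
    receivedSNR c γ h < t ↔ h < √(t / (c * γ)) := by
  rw [receivedSNR, Real.lt_sqrt hh.le, lt_div_iff₀' (by positivity)]

variable {c₁ c₂ t₁ t₂ : ℝ} {o : ℝ → ℝ → DecodingOrder}

lemma hasLaw_pair [IsProbabilityMeasure μ] (hlaw₁ : HasLaw h₁ (gammaGamma α β) μ)
    (hlaw₂ : HasLaw h₂ (gammaGamma α β) μ) (hind : IndepFun h₁ h₂ μ) :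
    HasLaw (fun ω => (h₁ ω, h₂ ω)) ((gammaGamma α β).prod (gammaGamma α β)) μ where
  aemeasurable := hlaw₁.aemeasurable.prodMk hlaw₂.aemeasurable
  map_eq := by
    rw [(indepFun_iff_map_prod_eq_prod_map_map hlaw₁.aemeasurable hlaw₂.aemeasurable).1 hind,
      hlaw₁.map_eq, hlaw₂.map_eq]

/-- Outage probability against the distribution function `F` of the turbulence: with
`x = √(t₁ / (c₁ γ))`, the outage event contains `{h₁ < x}`, and what it has outside of it lies in
an event `{h₁ < r x, h₂ < r' x}`, because for `t₁ t₂ < 1` both received SNRs are bounded when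
neither signal can be decoded first. -/
lemma outage₁_bounds [IsProbabilityMeasure μ] (sic : SIC)
    (hc₁ : 0 < c₁) (hc₂ : 0 < c₂) (ht₁ : 0 < t₁) (ht₂ : 0 < t₂)
    (hlaw₁ : HasLaw h₁ (gammaGamma α β) μ) (hlaw₂ : HasLaw h₂ (gammaGamma α β) μ)
    (hind : IndepFun h₁ h₂ μ) (ho : IsOptimalPolicy t₁ t₂ o) (ht : t₁ * t₂ < 1) :
    ∃ r > 0, ∃ r' > 0, ∀ γ > 0,
      (gammaGamma α β).real (Set.Iio √(t₁ / (c₁ * γ))) ≤ outage₁ μ sic o t₁ t₂ c₁ c₂ h₁ h₂ γ ∧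
      outage₁ μ sic o t₁ t₂ c₁ c₂ h₁ h₂ γ ≤ (gammaGamma α β).real (Set.Iio √(t₁ / (c₁ * γ))) +
        (gammaGamma α β).real (Set.Iio (r * √(t₁ / (c₁ * γ)))) *
        (gammaGamma α β).real (Set.Iio (r' * √(t₁ / (c₁ * γ)))) ∧
      outage₁ μ sic o t₁ t₂ c₁ c₂ h₁ h₂ γ
        ≤ (gammaGamma α β).real (Set.Iio (r * √(t₁ / (c₁ * γ)))) := by
  have hd : 0 < 1 - t₁ * t₂ := by linarith
  set M₁ := t₁ * (1 + t₂) / (1 - t₁ * t₂) with hM₁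
  set M₂ := t₂ * (1 + t₁) / (1 - t₁ * t₂) with hM₂
  have hM₁0 : 0 < M₁ := by positivity
  have hM₂0 : 0 < M₂ := by positivity
  have htM : t₁ ≤ M₁ := by
    rw [hM₁, le_div_iff₀ hd]
    nlinarith [mul_pos ht₁ ht₂, mul_pos ht₁ (mul_pos ht₁ ht₂)]
  refine ⟨√(M₁ / t₁), by positivity, √(M₂ * c₁ / (c₂ * t₁)), by positivity, fun γ hγ => ?_⟩
  have hpos₁ := ae_pos_of_hasLaw hlaw₁
  have hpos₂ := ae_pos_of_hasLaw hlaw₂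
  have hr : √(M₁ / t₁) * √(t₁ / (c₁ * γ)) = √(M₁ / (c₁ * γ)) := by
    rw [← Real.sqrt_mul (by positivity)]; congr 1; field_simp
  have hr' : √(M₂ * c₁ / (c₂ * t₁)) * √(t₁ / (c₁ * γ)) = √(M₂ / (c₂ * γ)) := by
    rw [← Real.sqrt_mul (by positivity)]; congr 1; field_simp
  rw [hr, hr']
  have e1 : ∀ y : ℝ, (gammaGamma α β).real (Set.Iio y) = μ.real {ω | h₁ ω < y} := fun y =>
    (hlaw₁.measureReal_eq (p := fun z => z < y) measurableSet_Iio).symm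
  have e2 : ∀ y y' : ℝ, (gammaGamma α β).real (Set.Iio y) * (gammaGamma α β).real (Set.Iio y')
      = μ.real {ω | h₁ ω < y ∧ h₂ ω < y'} := by
    intro y y'
    have : SFinite (gammaGamma α β) := by rw [← hlaw₁.map_eq]; infer_instance
    rw [← measureReal_prod_prod]
    exact ((hasLaw_pair hlaw₁ hlaw₂ hind).measureReal_eq (p := fun z => z ∈ Set.Iio y ×ˢ Set.Iio y')
      (measurableSet_Iio.prod measurableSet_Iio)).symm
  have hN : ∀ a b : ℝ, a < t₁ * (b + 1) → b < t₂ * (a + 1) → a < M₁ ∧ b < M₂ := by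
    intro a b hA hB
    rw [hM₁, hM₂, lt_div_iff₀ hd, lt_div_iff₀ hd]
    constructor <;> nlinarith
  have hout : ∀ᵐ ω ∂μ, sinr₁ sic (o (receivedSNR c₁ γ (h₁ ω)) (receivedSNR c₂ γ (h₂ ω))) t₂
      (receivedSNR c₁ γ (h₁ ω)) (receivedSNR c₂ γ (h₂ ω)) < t₁ →
      h₁ ω < √(t₁ / (c₁ * γ)) ∨ (h₁ ω < √(M₁ / (c₁ * γ)) ∧ h₂ ω < √(M₂ / (c₂ * γ))) := by
    filter_upwards [hpos₁, hpos₂] with ω ha hb h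
    rw [← receivedSNR_lt_iff hc₁ hγ ha, ← receivedSNR_lt_iff hc₁ hγ ha,
      ← receivedSNR_lt_iff hc₂ hγ hb]
    exact (lt_or_of_sinr₁_lt ho (receivedSNR_nonneg hc₁ hγ _) (receivedSNR_nonneg hc₂ hγ _) h).imp
      id fun h => hN _ _ h.1 h.2
  refine ⟨?_, ?_, ?_⟩
  · rw [e1, outage₁]
    refine ENNReal.toReal_mono (measure_ne_top _ _) (measure_mono_ae ?_)
    filter_upwards [hpos₁] with ω ha h
    exact (sinr₁_le _ _ _ (receivedSNR_nonneg hc₁ hγ _) (receivedSNR_nonneg hc₂ hγ _)).trans_lt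
      ((receivedSNR_lt_iff hc₁ hγ ha).2 h)
  · rw [e2, e1, outage₁]
    refine le_trans ?_ (measureReal_union_le _ _)
    exact ENNReal.toReal_mono (measure_ne_top _ _) (measure_mono_ae hout)
  · rw [e1, outage₁]
    refine ENNReal.toReal_mono (measure_ne_top _ _) (measure_mono_ae ?_)
    filter_upwards [hout] with ω hω h
    rcases hω h with h | h
    · exact lt_of_lt_of_le h (Real.sqrt_le_sqrt (by gcongr))
    · exact h.1

/-! ### Asymptotics of the outage probability without an outage floor -/

lemma tendsto_sqrt_div_atTop {t c : ℝ} (ht : 0 < t) (hc : 0 < c) :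
    Tendsto (fun γ : ℝ => √(t / (c * γ))) atTop (𝓝[>] 0) := by
  refine tendsto_nhdsWithin_iff.2 ⟨?_, ?_⟩
  · have h : Tendsto (fun γ : ℝ => t / (c * γ)) atTop (𝓝 0) :=
      tendsto_const_nhds.div_atTop (tendsto_id.const_mul_atTop hc)
    simpa using h.sqrt
  · filter_upwards [eventually_gt_atTop 0] with γ hγ
    exact Real.sqrt_pos.2 (by positivity)

lemma tendsto_gammaGamma_Iio_zero (hα : 0 < α) (hβ : 0 < β) :
    Tendsto (fun x => (gammaGamma α β).real (Set.Iio x)) (𝓝[>] 0) (𝓝 0) := by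
  have hm : 0 < min α β := lt_min hα hβ
  have hε : 0 < min 1 (min α β / 2) := by positivity
  have hεm : min 1 (min α β / 2) < min α β := (min_le_right _ _).trans_lt (by linarith)
  obtain ⟨C, hC, h⟩ := exists_gammaGamma_Iio_le_mul_rpow hα hβ hε (min_le_left _ _) hεm
  have hq : 0 < min α β - min 1 (min α β / 2) := by linarith
  have h0 : Tendsto (fun x : ℝ => C * x ^ (min α β - min 1 (min α β / 2))) (𝓝[>] 0) (𝓝 0) := by
    have := (Real.continuousAt_rpow_const 0 _ (Or.inr hq.le)).tendsto
    rw [Real.zero_rpow hq.ne'] at this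
    simpa using (this.mono_left nhdsWithin_le_nhds).const_mul C
  refine squeeze_zero' (Eventually.of_forall fun _ => measureReal_nonneg) ?_ h0
  filter_upwards [self_mem_nhdsWithin] with x hx using h x hx

/-- Power bounds whose exponents differ by an arbitrarily small amount determine the diversity
order. -/
lemma hasDiversityOrder_of_bounds {P : ℝ → ℝ} {d : ℝ}
    (hlow : ∃ c > 0, ∀ᶠ γ in atTop, c * γ ^ (-d) ≤ P γ)
    (hup : ∀ δ > 0, ∃ ε ≤ δ, ∃ C > 0, ∀ᶠ γ in atTop, P γ ≤ C * γ ^ (-(d - ε))) :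
    HasDiversityOrder P d := by
  obtain ⟨c, hc, hlow⟩ := hlow
  have hlim : ∀ C : ℝ, ∀ e : ℝ, Tendsto (fun γ => -Real.log C / Real.log γ + e) atTop (𝓝 e) := by
    intro C e
    simpa using (tendsto_const_nhds.div_atTop Real.tendsto_log_atTop).add_const e
  have hlog : ∀ C e γ : ℝ, 0 < C → 1 < γ →
      -Real.log (C * γ ^ (-e)) / Real.log γ = -Real.log C / Real.log γ + e := by
    intro C e γ hC hγ
    have h0 : 0 < γ := by linarith
    have hl : 0 < Real.log γ := Real.log_pos hγ
    rw [Real.log_mul hC.ne' (Real.rpow_pos_of_pos h0 _).ne', Real.log_rpow h0]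
    field_simp
    ring
  refine tendsto_order.2 ⟨fun a ha => ?_, fun a ha => ?_⟩
  · obtain ⟨ε, hε, C, hC, hP⟩ := hup ((d - a) / 2) (by linarith)
    filter_upwards [hlow, hP, eventually_gt_atTop 1,
      (hlim C (d - ε)).eventually_const_lt (by linarith : a < d - ε)] with γ h1 h2 hγ h3
    have h0 : 0 < γ := by linarith
    have hl : 0 < Real.log γ := Real.log_pos hγ
    have hP0 : 0 < P γ := lt_of_lt_of_le (by positivity) h1
    refine h3.trans_le ?_
    rw [← hlog C (d - ε) γ hC hγ]
    have := Real.log_le_log hP0 h2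
    gcongr
  · filter_upwards [hlow, eventually_gt_atTop 1, (hlim c d).eventually_lt_const ha] with γ h1 hγ h3
    have h0 : 0 < γ := by linarith
    have hl : 0 < Real.log γ := Real.log_pos hγ
    refine lt_of_le_of_lt ?_ h3
    rw [← hlog c d γ hc hγ]
    have := Real.log_le_log (by positivity) h1
    gcongr

lemma outage₁_isEquivalent_F₁ [IsProbabilityMeasure μ] (sic : SIC) (hα : 0 < α) (hβ : 0 < β)
    (hc₁ : 0 < c₁) (hc₂ : 0 < c₂) (ht₁ : 0 < t₁) (ht₂ : 0 < t₂)
    (hlaw₁ : HasLaw h₁ (gammaGamma α β) μ) (hlaw₂ : HasLaw h₂ (gammaGamma α β) μ)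
    (hind : IndepFun h₁ h₂ μ) (ho : IsOptimalPolicy t₁ t₂ o) (ht : t₁ * t₂ < 1) (hne : α ≠ β) :
    outage₁ μ sic o t₁ t₂ c₁ c₂ h₁ h₂ ~[atTop]
      (fun γ => F₁ α β (α * β * √(t₁ / (c₁ * γ)))) := by
  obtain ⟨r, hr, r', hr', hb⟩ := outage₁_bounds sic hc₁ hc₂ ht₁ ht₂ hlaw₁ hlaw₂ hind ho ht
  have hx := tendsto_sqrt_div_atTop ht₁ hc₁
  refine IsEquivalent.trans ?_ ((gammaGamma_Iio_isEquivalent_F₁ hα hβ hne).comp_tendsto hx)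
  have hO := (gammaGamma_Iio_mul_isBigO hα hβ hne hr).comp_tendsto hx
  have ho := (isLittleO_one_iff ℝ).2
    (((tendsto_gammaGamma_Iio_zero hα hβ).comp (tendsto_const_mul_nhdsGT_zero hr')).comp hx)
  have hOo := hO.mul_isLittleO ho
  simp only [mul_one] at hOo
  refine IsBigO.trans_isLittleO (IsBigO.of_bound 1 ?_) hOo
  filter_upwards [eventually_gt_atTop 0] with γ hγ
  obtain ⟨h1, h2, -⟩ := hb γ hγ
  simp only [Pi.sub_apply, Function.comp_apply, one_mul]
  rw [Real.norm_of_nonneg (by linarith), Real.norm_of_nonneg (by positivity)]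
  linarith

lemma tendsto_outage₁_zero [IsProbabilityMeasure μ] (sic : SIC) (hα : 0 < α) (hβ : 0 < β)
    (hc₁ : 0 < c₁) (hc₂ : 0 < c₂) (ht₁ : 0 < t₁) (ht₂ : 0 < t₂)
    (hlaw₁ : HasLaw h₁ (gammaGamma α β) μ) (hlaw₂ : HasLaw h₂ (gammaGamma α β) μ)
    (hind : IndepFun h₁ h₂ μ) (ho : IsOptimalPolicy t₁ t₂ o) (ht : t₁ * t₂ < 1) :
    Tendsto (outage₁ μ sic o t₁ t₂ c₁ c₂ h₁ h₂) atTop (𝓝 0) := by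
  obtain ⟨r, hr, r', hr', hb⟩ := outage₁_bounds sic hc₁ hc₂ ht₁ ht₂ hlaw₁ hlaw₂ hind ho ht
  have hx := tendsto_sqrt_div_atTop ht₁ hc₁
  refine squeeze_zero' (Eventually.of_forall fun _ => measureReal_nonneg) ?_
    (((tendsto_gammaGamma_Iio_zero hα hβ).comp (tendsto_const_mul_nhdsGT_zero hr)).comp hx)
  filter_upwards [eventually_gt_atTop 0] with γ hγ using (hb γ hγ).2.2

lemma hasDiversityOrder_outage₁ [IsProbabilityMeasure μ] (sic : SIC) (hα : 0 < α) (hβ : 0 < β)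
    (hc₁ : 0 < c₁) (hc₂ : 0 < c₂) (ht₁ : 0 < t₁) (ht₂ : 0 < t₂)
    (hlaw₁ : HasLaw h₁ (gammaGamma α β) μ) (hlaw₂ : HasLaw h₂ (gammaGamma α β) μ)
    (hind : IndepFun h₁ h₂ μ) (ho : IsOptimalPolicy t₁ t₂ o) (ht : t₁ * t₂ < 1) :
    HasDiversityOrder (outage₁ μ sic o t₁ t₂ c₁ c₂ h₁ h₂) (1 / 2 * min α β) := by
  obtain ⟨r, hr, r', hr', hb⟩ := outage₁_bounds sic hc₁ hc₂ ht₁ ht₂ hlaw₁ hlaw₂ hind ho ht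
  have hx := tendsto_sqrt_div_atTop ht₁ hc₁
  have hm : 0 < min α β := lt_min hα hβ
  have hpow : ∀ γ > 0, ∀ q : ℝ, √(t₁ / (c₁ * γ)) ^ q = (t₁ / c₁) ^ (q / 2) * γ ^ (-(q / 2)) := by
    intro γ hγ q
    rw [Real.sqrt_eq_rpow, ← Real.rpow_mul (by positivity), ← div_div,
      Real.div_rpow (by positivity) hγ.le, Real.rpow_neg hγ.le, div_eq_mul_inv,
      show 1 / 2 * q = q / 2 by ring]
  refine hasDiversityOrder_of_bounds ?_ fun δ hδ => ?_
  · obtain ⟨c, hc, h⟩ := exists_mul_rpow_le_gammaGamma_Iio hα hβ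
    refine ⟨c * (t₁ / c₁) ^ (min α β / 2), by positivity, ?_⟩
    filter_upwards [eventually_gt_atTop 0,
      hx.eventually (Ioc_mem_nhdsGT one_pos)] with γ hγ hxγ
    have := (h _ hxγ.1 hxγ.2).trans (hb γ hγ).1
    rwa [hpow γ hγ, ← mul_assoc, show min α β / 2 = 1 / 2 * min α β by ring] at *
  · set ε := min (min 1 δ) (min α β / 2) with hε
    have hε0 : 0 < ε := by positivity
    have hε1 : ε ≤ 1 := (min_le_left _ _).trans (min_le_left _ _)
    have hεδ : ε ≤ δ := (min_le_left _ _).trans (min_le_right _ _)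
    have hεm : ε < min α β := (min_le_right _ _).trans_lt (by linarith)
    obtain ⟨C, hC, h⟩ := exists_gammaGamma_Iio_le_mul_rpow hα hβ hε0 hε1 hεm
    refine ⟨ε / 2, by linarith, C * r ^ (min α β - ε) * (t₁ / c₁) ^ ((min α β - ε) / 2),
      by positivity, ?_⟩
    filter_upwards [eventually_gt_atTop 0] with γ hγ
    have hs : 0 < √(t₁ / (c₁ * γ)) := Real.sqrt_pos.2 (by positivity)
    refine ((hb γ hγ).2.2.trans (h _ (mul_pos hr hs))).trans (le_of_eq ?_)
    rw [Real.mul_rpow hr.le hs.le, hpow γ hγ,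
      show -(1 / 2 * min α β - ε / 2) = -((min α β - ε) / 2) by ring]
    ring

/-! ### The outage floor -/

/-- If the cancellation is not perfect, the outage event converges to the event that neither
threshold is exceeded by the limiting ratio of the two received SNRs. -/
lemma tendsto_outage₁_floor [IsProbabilityMeasure μ] {sic : SIC} (hsic : sic ≠ .perfect)
    (hα : 0 < α) (hβ : 0 < β) (hc₁ : 0 < c₁) (hc₂ : 0 < c₂) (ht₁ : 0 < t₁) (ht₂ : 0 < t₂)
    (hlaw₁ : HasLaw h₁ (gammaGamma α β) μ) (hlaw₂ : HasLaw h₂ (gammaGamma α β) μ)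
    (hind : IndepFun h₁ h₂ μ) (ho : IsOptimalPolicy t₁ t₂ o) :
    Tendsto (outage₁ μ sic o t₁ t₂ c₁ c₂ h₁ h₂) atTop (𝓝 (μ.real
      {ω | c₁ * h₁ ω ^ 2 ≤ t₁ * (c₂ * h₂ ω ^ 2) ∧ c₂ * h₂ ω ^ 2 ≤ t₂ * (c₁ * h₁ ω ^ 2)})) := by
  have := isProbabilityMeasure_gammaGamma hα hβ
  have hpair := hasLaw_pair hlaw₁ hlaw₂ hind
  have hpos₁ := ae_pos_of_hasLaw hlaw₁
  set N : ℝ → ℝ × ℝ → Prop := fun γ p =>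
    receivedSNR c₁ γ p.1 < t₁ * (receivedSNR c₂ γ p.2 + 1) ∧
      receivedSNR c₂ γ p.2 < t₂ * (receivedSNR c₁ γ p.1 + 1) with hN
  have hNmeas : ∀ γ, MeasurableSet {p | N γ p} := by
    intro γ
    simp only [hN, receivedSNR]
    measurability
  set S : ℝ × ℝ → Prop := fun p =>
    c₁ * p.1 ^ 2 ≤ t₁ * (c₂ * p.2 ^ 2) ∧ c₂ * p.2 ^ 2 ≤ t₂ * (c₁ * p.1 ^ 2) with hS
  have hSmeas : MeasurableSet {p | S p} := by
    simp only [hS]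
    measurability
  -- `c γ u < t (c' γ v + 1)` reads `γ (c u - t c' v) < t`: as `γ → ∞` it is decided by the sign.
  have hlim : ∀ u v t : ℝ, 0 < t →
      ∀ᶠ γ : ℝ in atTop, (γ * u < t * (γ * v + 1) ↔ u ≤ t * v) := by
    intro u v t ht
    rcases le_or_gt u (t * v) with h | h
    · filter_upwards [eventually_gt_atTop 0] with γ hγ
      simp only [h, iff_true]
      nlinarith [mul_le_mul_of_nonneg_left h hγ.le]
    · have hD : 0 < u - t * v := by linarith
      filter_upwards [eventually_gt_atTop (t / (u - t * v))] with γ hγ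
      rw [div_lt_iff₀ hD] at hγ
      simp only [h.not_ge, iff_false, not_lt]
      nlinarith
  have hNS : Tendsto (fun γ => μ.real {ω | N γ (h₁ ω, h₂ ω)}) atTop
      (𝓝 (μ.real {ω | S (h₁ ω, h₂ ω)})) := by
    rw [hpair.measureReal_eq hSmeas]
    simp_rw [fun γ => hpair.measureReal_eq (hNmeas γ)]
    refine (ENNReal.tendsto_toReal (measure_ne_top _ _)).comp
      (tendsto_measure_of_ae_tendsto_indicator_of_isFiniteMeasure atTop hSmeas hNmeas
        (Eventually.of_forall fun p => ?_))
    filter_upwards [hlim (c₁ * p.1 ^ 2) (c₂ * p.2 ^ 2) t₁ ht₁,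
      hlim (c₂ * p.2 ^ 2) (c₁ * p.1 ^ 2) t₂ ht₂] with γ hA hB
    simp only [hN, hS, receivedSNR, mul_right_comm _ γ, ← hA, ← hB,
      mul_comm γ]
  have hsmall := (tendsto_gammaGamma_Iio_zero hα hβ).comp (tendsto_sqrt_div_atTop ht₁ hc₁)
  have hupper := hNS.add hsmall
  rw [add_zero] at hupper
  refine tendsto_of_tendsto_of_tendsto_of_le_of_le' hNS hupper ?_ ?_
  · filter_upwards [eventually_gt_atTop 0] with γ hγ
    exact measureReal_mono fun ω h => sinr₁_lt_of_lt hsic _ ht₁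
      (receivedSNR_nonneg hc₁ hγ _) (receivedSNR_nonneg hc₂ hγ _) h.1 h.2
  · filter_upwards [eventually_gt_atTop 0] with γ hγ
    have e1 : (gammaGamma α β).real (Set.Iio √(t₁ / (c₁ * γ)))
        = μ.real {ω | h₁ ω < √(t₁ / (c₁ * γ))} :=
      (hlaw₁.measureReal_eq (p := fun z => z < √(t₁ / (c₁ * γ))) measurableSet_Iio).symm
    simp only [Function.comp_apply]
    rw [e1, outage₁]
    refine le_trans ?_ (measureReal_union_le _ _)
    refine ENNReal.toReal_mono (measure_ne_top _ _) (measure_mono_ae ?_)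
    filter_upwards [hpos₁] with ω ha h
    refine (lt_or_of_sinr₁_lt ho (receivedSNR_nonneg hc₁ hγ _)
      (receivedSNR_nonneg hc₂ hγ _) h).symm.imp id fun h => ?_
    exact (receivedSNR_lt_iff hc₁ hγ ha).1 h

lemma measureReal_le_sub_measureReal_le [IsFiniteMeasure μ] {R : Ω → ℝ} (hR : AEMeasurable R μ)
    {u v : ℝ} (huv : u ≤ v) :
    μ.real {ω | R ω ≤ v} - μ.real {ω | R ω ≤ u} = μ.real ({ω | R ω ≤ v} \ {ω | R ω ≤ u}) := by
  have hm : NullMeasurableSet {ω | R ω ≤ u} μ := hR.nullMeasurable measurableSet_Iic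
  have hsub : {ω | R ω ≤ u} ⊆ {ω | R ω ≤ v} := fun ω h => le_trans h huv
  have h := measureReal_inter_add_sdiff₀ (s := {ω | R ω ≤ v}) hm
  rw [Set.inter_eq_right.2 hsub] at h
  linarith

/-- The limit event in terms of the quotient `h₁ / h₂`. -/
lemma measureReal_floor_eq [IsProbabilityMeasure μ] (hα : 0 < α) (hβ : 0 < β)
    (hc₁ : 0 < c₁) (hc₂ : 0 < c₂) (ht₂ : 0 < t₂)
    (hlaw₁ : HasLaw h₁ (gammaGamma α β) μ) (hlaw₂ : HasLaw h₂ (gammaGamma α β) μ)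
    (hind : IndepFun h₁ h₂ μ) (ht : 1 ≤ t₁ * t₂) :
    μ.real {ω | c₁ * h₁ ω ^ 2 ≤ t₁ * (c₂ * h₂ ω ^ 2) ∧ c₂ * h₂ ω ^ 2 ≤ t₂ * (c₁ * h₁ ω ^ 2)}
      = μ.real {ω | h₁ ω / h₂ ω ≤ √(c₂ / c₁ * t₁)} -
        μ.real {ω | h₁ ω / h₂ ω ≤ √(c₂ / c₁ / t₂)} := by
  have huv : √(c₂ / c₁ / t₂) ≤ √(c₂ / c₁ * t₁) := by
    refine Real.sqrt_le_sqrt ?_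
    rw [div_le_iff₀ ht₂, mul_assoc]
    exact le_mul_of_one_le_right (by positivity) ht
  rw [measureReal_le_sub_measureReal_le (R := fun ω => h₁ ω / h₂ ω)
    (hlaw₁.aemeasurable.div hlaw₂.aemeasurable) huv]
  refine measureReal_congr ?_
  have hne : ∀ᵐ ω ∂μ, h₁ ω / h₂ ω ≠ √(c₂ / c₁ / t₂) := by
    simpa [ae_iff] using measure_div_eq_zero hα hβ hlaw₁ hlaw₂ hind √(c₂ / c₁ / t₂)
  filter_upwards [ae_pos_of_hasLaw hlaw₁, ae_pos_of_hasLaw hlaw₂, hne] with ω ha hb hn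
  refine propext ?_
  change (c₁ * h₁ ω ^ 2 ≤ t₁ * (c₂ * h₂ ω ^ 2) ∧ c₂ * h₂ ω ^ 2 ≤ t₂ * (c₁ * h₁ ω ^ 2)) ↔
    (h₁ ω / h₂ ω ≤ √(c₂ / c₁ * t₁) ∧ ¬ h₁ ω / h₂ ω ≤ √(c₂ / c₁ / t₂))
  have hq : 0 < h₁ ω / h₂ ω := div_pos ha hb
  have e1 : c₁ * h₁ ω ^ 2 ≤ t₁ * (c₂ * h₂ ω ^ 2) ↔ h₁ ω / h₂ ω ≤ √(c₂ / c₁ * t₁) := by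
    rw [Real.le_sqrt' hq, div_pow, div_le_iff₀ (by positivity), div_mul_eq_mul_div,
      div_mul_eq_mul_div, le_div_iff₀ hc₁]
    ring_nf
  have e2 : c₂ * h₂ ω ^ 2 ≤ t₂ * (c₁ * h₁ ω ^ 2) ↔ √(c₂ / c₁ / t₂) ≤ h₁ ω / h₂ ω := by
    rw [Real.sqrt_le_left hq.le, div_pow, le_div_iff₀ (by positivity), div_div,
      div_mul_eq_mul_div, div_le_iff₀ (by positivity)]
    ring_nf
  rw [e1, e2, not_le, lt_iff_le_and_ne]
  exact and_congr_right fun _ => ⟨fun h => ⟨h, hn.symm⟩, fun h => h.1⟩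

lemma gammaGamma_Ioo_pos (hα : 0 < α) (hβ : 0 < β) {a b : ℝ} (ha : 0 < a) (hab : a < b) :
    0 < gammaGamma α β (Set.Ioo a b) := by
  have hΓα := Real.Gamma_pos_of_pos hα
  have hΓβ := Real.Gamma_pos_of_pos hβ
  have hb : 0 < b := ha.trans hab
  have hB := besselInt_pos (β - α) (by positivity : 0 < α * β * b)
  set g : ℝ → ℝ := fun u => (α * β) ^ α / (Real.Gamma α * Real.Gamma β) * u ^ (α - 1)
    * besselInt (β - α) (α * β * b) with hg
  have hgm : Measurable fun u => ENNReal.ofReal (g u) := by fun_prop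
  have hpos : 0 < ∫⁻ u in Set.Ioo a b, ENNReal.ofReal (g u) := by
    rw [setLIntegral_pos_iff hgm]
    refine lt_of_lt_of_le ?_ (measure_mono (s := Set.Ioo a b) fun u hu => ⟨?_, hu⟩)
    · simpa using hab
    · have hu0 : 0 < u := ha.trans hu.1
      simp only [Function.mem_support, ne_eq, ENNReal.ofReal_eq_zero, not_le, hg]
      positivity
  refine hpos.trans_le ?_
  rw [gammaGamma, withDensity_apply _ measurableSet_Ioo]
  refine setLIntegral_mono' measurableSet_Ioo fun u hu => ENNReal.ofReal_le_ofReal ?_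
  have hu0 : 0 < u := ha.trans hu.1
  rw [gammaGammaPDF_of_pos hα hβ hu0]
  simp only [hg]
  gcongr
  exact besselInt_le_besselInt _ (by positivity) (by gcongr; exact hu.2.le)

/-- The distribution function of the quotient is strictly increasing on `(0, ∞)`: between `u` and
`v` the quotient takes values with positive probability, for instance when `h₂` is slightly larger
than `1` and `h₁` slightly smaller than `v`. -/
lemma measureReal_div_le_lt [IsProbabilityMeasure μ] (hα : 0 < α) (hβ : 0 < β)
    (hlaw₁ : HasLaw h₁ (gammaGamma α β) μ) (hlaw₂ : HasLaw h₂ (gammaGamma α β) μ)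
    (hind : IndepFun h₁ h₂ μ) {u v : ℝ} (hu : 0 < u) (huv : u < v) :
    μ.real {ω | h₁ ω / h₂ ω ≤ u} < μ.real {ω | h₁ ω / h₂ ω ≤ v} := by
  have := isProbabilityMeasure_gammaGamma hα hβ
  obtain ⟨w, huw, hwv⟩ := exists_between huv
  have hw1 : 1 < w / u := (one_lt_div hu).2 huw
  have hw : 0 < w := hu.trans huw
  have hE : 0 < μ.real {ω | (h₁ ω, h₂ ω) ∈ Set.Ioo w v ×ˢ Set.Ioo 1 (w / u)} := by
    rw [(hasLaw_pair hlaw₁ hlaw₂ hind).measureReal_eq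
      (p := fun z => z ∈ Set.Ioo w v ×ˢ Set.Ioo 1 (w / u))
      (measurableSet_Ioo.prod measurableSet_Ioo)]
    change 0 < ((gammaGamma α β).prod (gammaGamma α β)).real (Set.Ioo w v ×ˢ Set.Ioo 1 (w / u))
    rw [measureReal_prod_prod]
    exact mul_pos (ENNReal.toReal_pos (gammaGamma_Ioo_pos hα hβ hw hwv).ne' (measure_ne_top _ _))
      (ENNReal.toReal_pos (gammaGamma_Ioo_pos hα hβ one_pos hw1).ne' (measure_ne_top _ _))
  rw [← sub_pos, measureReal_le_sub_measureReal_le (R := fun ω => h₁ ω / h₂ ω)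
    (hlaw₁.aemeasurable.div hlaw₂.aemeasurable) huv.le]
  refine hE.trans_le (measureReal_mono ?_)
  rintro ω ⟨⟨ha1, ha2⟩, hb1, hb2⟩
  simp only at ha1 ha2 hb1 hb2
  have hb0 : 0 < h₂ ω := one_pos.trans hb1
  rw [lt_div_iff₀ hu] at hb2
  refine ⟨?_, ?_⟩
  · change h₁ ω / h₂ ω ≤ v
    rw [div_le_iff₀ hb0]
    nlinarith [hu.trans huv]
  · change ¬ h₁ ω / h₂ ω ≤ u
    rw [not_le, lt_div_iff₀ hb0]
    linarith

end FSONOMA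

theorem corollary1 {Ω : Type*} [MeasurableSpace Ω] (μ : Measure Ω) [IsProbabilityMeasure μ]
    (α β c₁ c₂ t₁ t₂ : ℝ) (hα : 0 < α) (hβ : 0 < β) (hc₁ : 0 < c₁) (hc₂ : 0 < c₂)
    (ht₁ : 0 < t₁) (ht₂ : 0 < t₂) (h₁ h₂ : Ω → ℝ)
    (hlaw₁ : HasLaw h₁ (FSONOMA.gammaGamma α β) μ) (hlaw₂ : HasLaw h₂ (FSONOMA.gammaGamma α β) μ)
    (hind : IndepFun h₁ h₂ μ) (sic : FSONOMA.SIC) (o : ℝ → ℝ → FSONOMA.DecodingOrder)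
    (ho : FSONOMA.IsOptimalPolicy t₁ t₂ o) :
    (t₁ * t₂ < 1 →
      ((∀ k : ℤ, α - β ≠ k) →
        FSONOMA.outage₁ μ sic o t₁ t₂ c₁ c₂ h₁ h₂ ~[atTop]
          (fun γ => FSONOMA.F₁ α β (α * β * √(t₁ / (c₁ * γ)))) ∧
        FSONOMA.outage₂ μ sic o t₁ t₂ c₁ c₂ h₁ h₂ ~[atTop]
          (fun γ => FSONOMA.F₁ α β (α * β * √(t₂ / (c₂ * γ))))) ∧
      Tendsto (FSONOMA.outage₁ μ sic o t₁ t₂ c₁ c₂ h₁ h₂) atTop (𝓝 0) ∧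
      Tendsto (FSONOMA.outage₂ μ sic o t₁ t₂ c₁ c₂ h₁ h₂) atTop (𝓝 0) ∧
      FSONOMA.HasDiversityOrder (FSONOMA.outage₁ μ sic o t₁ t₂ c₁ c₂ h₁ h₂) (1 / 2 * min α β) ∧
      FSONOMA.HasDiversityOrder (FSONOMA.outage₂ μ sic o t₁ t₂ c₁ c₂ h₁ h₂) (1 / 2 * min α β)) ∧
    (∀ σ : ℝ, FSONOMA.Separates σ 2 3 (FSONOMA.upperParams α β) (FSONOMA.lowerParams α β) →
      (∀ x : ℝ, 0 < x → μ.real {ω | h₁ ω / h₂ ω ≤ x} = FSONOMA.F₂ σ α β x) ∧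
      (1 ≤ t₁ * t₂ → sic ≠ FSONOMA.SIC.perfect →
        Tendsto (FSONOMA.outage₁ μ sic o t₁ t₂ c₁ c₂ h₁ h₂) atTop
          (𝓝 (FSONOMA.F₂ σ α β √(c₂ / c₁ * t₁) - FSONOMA.F₂ σ α β √(c₂ / c₁ / t₂))) ∧
        Tendsto (FSONOMA.outage₂ μ sic o t₁ t₂ c₁ c₂ h₁ h₂) atTop
          (𝓝 (FSONOMA.F₂ σ α β √(c₂ / c₁ * t₁) - FSONOMA.F₂ σ α β √(c₂ / c₁ / t₂)))) ∧
      (1 < t₁ * t₂ →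
        0 < FSONOMA.F₂ σ α β √(c₂ / c₁ * t₁) - FSONOMA.F₂ σ α β √(c₂ / c₁ / t₂))) := by
  have hpolicy := ho.swap
  have hlt : t₁ * t₂ < 1 → t₂ * t₁ < 1 := fun h => by rwa [mul_comm]
  rw [FSONOMA.outage₂_eq_outage₁_swap]
  refine ⟨fun ht => ⟨fun hint => ?_, ?_, ?_, ?_, ?_⟩, fun σ hsep => ?_⟩
  · have hne : α ≠ β := fun h => hint 0 (by simp [h])
    exact ⟨FSONOMA.outage₁_isEquivalent_F₁ sic hα hβ hc₁ hc₂ ht₁ ht₂ hlaw₁ hlaw₂ hind ho ht hne,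
      FSONOMA.outage₁_isEquivalent_F₁ sic hα hβ hc₂ hc₁ ht₂ ht₁ hlaw₂ hlaw₁ hind.symm hpolicy
        (hlt ht) hne⟩
  · exact FSONOMA.tendsto_outage₁_zero sic hα hβ hc₁ hc₂ ht₁ ht₂ hlaw₁ hlaw₂ hind ho ht
  · exact FSONOMA.tendsto_outage₁_zero sic hα hβ hc₂ hc₁ ht₂ ht₁ hlaw₂ hlaw₁ hind.symm hpolicy
      (hlt ht)
  · exact FSONOMA.hasDiversityOrder_outage₁ sic hα hβ hc₁ hc₂ ht₁ ht₂ hlaw₁ hlaw₂ hind ho ht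
  · exact FSONOMA.hasDiversityOrder_outage₁ sic hα hβ hc₂ hc₁ ht₂ ht₁ hlaw₂ hlaw₁ hind.symm hpolicy
      (hlt ht)
  · have hF : ∀ x : ℝ, 0 < x → μ.real {ω | h₁ ω / h₂ ω ≤ x} = FSONOMA.F₂ σ α β x := fun x hx =>
      FSONOMA.measureReal_div_le_eq_F₂ hα hβ hlaw₁ hlaw₂ hind hsep hx
    have hu : 0 < √(c₂ / c₁ / t₂) := by positivity
    have hv : 0 < √(c₂ / c₁ * t₁) := by positivity
    rw [← hF _ hu, ← hF _ hv]
    refine ⟨hF, fun ht hsic => ?_, fun ht => ?_⟩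
    · rw [← FSONOMA.measureReal_floor_eq hα hβ hc₁ hc₂ ht₂ hlaw₁ hlaw₂ hind ht]
      refine ⟨FSONOMA.tendsto_outage₁_floor hsic hα hβ hc₁ hc₂ ht₁ ht₂ hlaw₁ hlaw₂ hind ho, ?_⟩
      have h := FSONOMA.tendsto_outage₁_floor hsic hα hβ hc₂ hc₁ ht₂ ht₁ hlaw₂ hlaw₁ hind.symm
        hpolicy
      -- The limit event is symmetric in the two base stations.
      simpa only [and_comm] using h
    · refine sub_pos.2 (FSONOMA.measureReal_div_le_lt hα hβ hlaw₁ hlaw₂ hind hu ?_)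
      refine Real.sqrt_lt_sqrt (by positivity) ?_
      rw [div_lt_iff₀ ht₂, mul_assoc]
      exact lt_mul_of_one_lt_right (by positivity) ht
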